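/- **Theorem.** A decomposition of an object $U$ of a category is a presentation $U = V \amalg W$ of $U$ as a binary coproduct, considered up to isomorphism of $V$ and $W$ over $U$. (A) Let $f \colon \mathscr Y \to \mathscr X$ be a morphism of (Grothendieck) topoi, with pushforward $f_*$ and left exact left adjoint $f^*$, and let $\mathscr X_0 \subseteq \mathscr X$ be a small set of generators. Then the following are equivalent: 1. the pushforward $f_* \colon \mathscr Y \to \mathscr X$ preserves finite coproducts (including the initial object); 2. for every $U \in \mathscr X$, every decomposition $f^*U = V \amalg W$ is obtained by pullback from a unique decomposition of $U$; 3. for every $U \in \mathscr X_0$, every decomposition $f^*U = V \amalg W$ is obtained by pullback from a unique decomposition of $U$. (B) Let $f \colon Y \to X$ be a dominant morphism of normal integral schemes, and let $\mathscr X_0$ be a small set of generators of $\operatorname{Sh}(X_{\text{ét}})$. For the induced morphism of étale topoi $\operatorname{Sh}(Y_{\text{ét}}) \to \operatorname{Sh}(X_{\text{ét}})$, conditions 1, 2, 3 are equivalent to each of the following: 5. the generic fibre of $f$ is geometrically connected over the residue field of the generic point of $X$; 6. the extension of function fields $K(X) \to K(Y)$ is primary, i.e. every element of $K(Y)$ that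 is separable algebraic over $K(X)$ lies in $K(X)$. If moreover $X$ is quasi-separated, then these are also equivalent to: 4. for every finitely presented, separated, étale morphism $V \to X$, the projection $f^*V := V \times_X Y \to V$ induces a bijection $\pi_0(f^*V) \to \pi_0(V)$ on sets of connected components. -/

import Mathlib

open CategoryTheory Limits Opposite AlgebraicGeometry

universe w v₁ v₂ u₁ u₂ u

noncomputable section

namespace Topoi

/-- A (Grothendieck) topos, relative to the universe `w`: a category equivalent to the category of
sheaves of sets on a small site. -/
class IsTopos (E : Type u₁) [Category.{v₁} E] : Prop where
  exists_site : ∃ (C : Type w) (_ : SmallCategory C) (J : GrothendieckTopology C),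
    Nonempty (E ≌ Sheaf J (Type w))

/-- A morphism of topoi (geometric morphism) `𝒴 → 𝒳`: a pushforward functor `𝒴 ⥤ 𝒳` together with
a left adjoint pullback functor `𝒳 ⥤ 𝒴` that preserves finite limits. -/
structure GeometricMorphism (𝒴 : Type u₁) [Category.{v₁} 𝒴] (𝒳 : Type u₂) [Category.{v₂} 𝒳] where
  /-- the pushforward `f_*` -/
  pushforward : 𝒴 ⥤ 𝒳
  /-- the pullback `f^*` -/
  pullback : 𝒳 ⥤ 𝒴
  /-- `f^*` is left adjoint to `f_*` -/
  adj : pullback ⊣ pushforward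
  /-- `f^*` is left exact -/
  preservesFiniteLimits_pullback : PreservesFiniteLimits pullback

/-- A decomposition `U = V ⨿ W` of an object `U`. -/
structure Decomposition {C : Type u₁} [Category.{v₁} C] (U : C) where
  /-- the first summand `V` -/
  left : C
  /-- the second summand `W` -/
  right : C
  /-- the coprojection `V ⟶ U` -/
  inl : left ⟶ U
  /-- the coprojection `W ⟶ U` -/
  inr : right ⟶ U
  /-- the coprojections exhibit `U` as the coproduct of `V` and `W` -/
  isColimit : IsColimit (BinaryCofan.mk inl inr)

/-- Two decompositions of `U` are the same if their summands are isomorphic over `U`. -/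
def Decomposition.Same {C : Type u₁} [Category.{v₁} C] {U : C} (D E : Decomposition U) : Prop :=
  (∃ e : D.left ≅ E.left, e.hom ≫ E.inl = D.inl) ∧
    (∃ e : D.right ≅ E.right, e.hom ≫ E.inr = D.inr)

namespace GeometricMorphism

variable {𝒴 : Type u₁} [Category.{v₁} 𝒴] {𝒳 : Type u₂} [Category.{v₂} 𝒳]
  (f : GeometricMorphism 𝒴 𝒳)

/-- The pullback `f^*U = f^*V ⨿ f^*W` of a decomposition `U = V ⨿ W`. -/
def pullbackDecomposition {U : 𝒳} (D : Decomposition U) : Decomposition (f.pullback.obj U) where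
  left := f.pullback.obj D.left
  right := f.pullback.obj D.right
  inl := f.pullback.map D.inl
  inr := f.pullback.map D.inr
  isColimit :=
    haveI := f.adj.leftAdjoint_preservesColimits
    mapIsColimitOfPreservesOfIsColimit f.pullback D.inl D.inr D.isColimit

/-- Every decomposition of `f^*U` is obtained by pullback from a unique decomposition of `U`. -/
def DecompositionsDescendUniquely (U : 𝒳) : Prop :=
  ∀ D : Decomposition (f.pullback.obj U), ∃ E : Decomposition U,
    (f.pullbackDecomposition E).Same D ∧
      ∀ E' : Decomposition U, (f.pullbackDecomposition E').Same D → E'.Same E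

end GeometricMorphism

end Topoi

namespace EtaleTopos

open Scheme

/-- The étale topos of a scheme: sheaves of sets on the small étale site. -/
abbrev EtaleSheaf (X : Scheme.{u}) : Type (u + 1) := Sheaf X.smallEtaleTopology (Type u)

/-- The étale topos of a scheme is a topos. -/
instance isTopos_etaleSheaf (X : Scheme.{u}) : Topoi.IsTopos.{u} (EtaleSheaf X) where
  exists_site := by
    let e := equivSmallModel.{u} X.AffineEtale
    exact ⟨SmallModel.{u} X.AffineEtale, inferInstance, e.inverse.inducedTopology
      (AffineEtale.topology X), ⟨(AffineEtale.sheafEquiv X (Type u)).symm.trans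
        (e.sheafCongr (AffineEtale.topology X) _ (Type u))⟩⟩

variable {X Y : Scheme.{u}} (f : Y ⟶ X)

/-- The class of étale morphisms of schemes. -/
def etaleMorphisms : MorphismProperty Scheme.{u} := @Etale

instance isStableUnderBaseChange_etaleMorphisms :
    etaleMorphisms.{u}.IsStableUnderBaseChange :=
  inferInstanceAs (MorphismProperty.IsStableUnderBaseChange @Etale.{u})

/-- Base change along `f : Y ⟶ X`, as a functor `V ↦ V ×[X] Y` between small étale sites. -/
def etalePullback : X.Etale ⥤ Y.Etale := MorphismProperty.Over.pullback etaleMorphisms ⊤ f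

/-- Base change of étale schemes is computed as base change of schemes. -/
def etalePullbackForgetIso :
    etalePullback f ⋙ Etale.forget Y ≅ Etale.forget X ⋙ Over.pullback f :=
  MorphismProperty.Over.pullbackCompForgetIso (P := etaleMorphisms) (Q := ⊤) f

instance preservesFiniteLimits_etalePullback : PreservesFiniteLimits (etalePullback f) := by
  have : PreservesFiniteLimits (Over.pullback f) := by
    have := (Over.mapPullbackAdj f).rightAdjoint_preservesLimits
    infer_instance
  have : PreservesFiniteLimits (etalePullback f ⋙ Etale.forget Y) :=
    preservesFiniteLimits_of_natIso (etalePullbackForgetIso f).symm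
  exact preservesFiniteLimits_of_reflects_of_preserves _ (Etale.forget Y)

instance representablyFlat_etalePullback : RepresentablyFlat (etalePullback f) :=
  flat_of_preservesFiniteLimits _

lemma coverPreserving_etalePullback :
    CoverPreserving X.smallEtaleTopology Y.smallEtaleTopology (etalePullback f) where
  cover_preserve {U S} hS := by
    obtain ⟨ι, Z, g, rfl⟩ := S.exists_eq_ofArrows
    rw [Sieve.ofArrows, ← Sieve.generate_map_eq_functorPushforward, Presieve.map_ofArrows]
    rw [ofArrows_mem_smallEtaleTopology_iff] at hS
    refine (ofArrows_mem_smallEtaleTopology_iff _).2 ?_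
    ext y
    simp only [Set.mem_iUnion, Set.mem_range, Set.mem_univ, iff_true]
    change ↥(pullback U.hom f) at y
    obtain ⟨i, z, hz⟩ : ∃ i, ∃ z, (g i).left z = pullback.fst U.hom f y := by
      have : pullback.fst U.hom f y ∈ ⋃ i, Set.range (g i).left := hS ▸ Set.mem_univ _
      simpa using this
    have hw : (g i).left ≫ U.hom = (Z i).hom := CategoryTheory.Over.w ((Etale.forget X).map (g i))
    have h₁ : ((etalePullback f).map (g i)).left ≫ pullback.fst U.hom f =
        pullback.fst (Z i).hom f ≫ (g i).left := pullback.lift_fst _ _ _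
    have h₂ : ((etalePullback f).map (g i)).left ≫ pullback.snd U.hom f =
        pullback.snd (Z i).hom f := pullback.lift_snd _ _ _
    have sq : IsPullback ((etalePullback f).map (g i)).left (pullback.fst (Z i).hom f)
        (pullback.fst U.hom f) (g i).left := by
      refine IsPullback.of_right ?_ h₁ (IsPullback.of_hasPullback U.hom f).flip
      rw [h₂, hw]
      exact (IsPullback.of_hasPullback (Z i).hom f).flip
    obtain ⟨p, hp, -⟩ := exists_preimage_of_isPullback sq y z hz.symm
    exact ⟨i, p, hp⟩

instance isContinuous_etalePullback :
    (etalePullback f).IsContinuous X.smallEtaleTopology Y.smallEtaleTopology :=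
  Functor.isContinuous_iff_coverPreserving.2 (coverPreserving_etalePullback f)

/-- The pushforward of étale sheaves along `f : Y ⟶ X`, given by `(f_* ℱ)(V) = ℱ(V ×[X] Y)`. -/
abbrev etalePushforward : EtaleSheaf Y ⥤ EtaleSheaf X :=
  (etalePullback f).sheafPushforwardContinuous (Type u) X.smallEtaleTopology Y.smallEtaleTopology

/-- Base change along `f`, restricted to affine étale `X`-schemes. -/
def affineEtalePullback : X.AffineEtale ⥤ Y.Etale := AffineEtale.Spec X ⋙ etalePullback f

instance isContinuous_affineEtalePullback :
    (affineEtalePullback f).IsContinuous (AffineEtale.topology X) Y.smallEtaleTopology :=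
  Functor.isContinuous_comp _ _ _ X.smallEtaleTopology _

instance hasLeftKanExtension_affineEtalePullback (F : X.AffineEtaleᵒᵖ ⥤ Type u) :
    (affineEtalePullback f).op.HasLeftKanExtension F := by
  have : (affineEtalePullback f).op.HasPointwiseLeftKanExtension F := fun U ↦ by
    have : EssentiallySmall.{u} (CostructuredArrow (affineEtalePullback f).op U) := inferInstance
    have : HasColimitsOfShape (CostructuredArrow (affineEtalePullback f).op U) (Type u) :=
      hasColimitsOfShape_of_essentiallySmall.{u} _ _
    dsimp [Functor.HasPointwiseLeftKanExtensionAt]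
    infer_instance
  infer_instance

instance isRightAdjoint_etalePushforward : (etalePushforward f).IsRightAdjoint := by
  let e := (AffineEtale.Spec X).sheafPushforwardContinuous (Type u)
    (AffineEtale.topology X) X.smallEtaleTopology
  let a := (affineEtalePullback f).sheafPushforwardContinuous (Type u)
    (AffineEtale.topology X) Y.smallEtaleTopology
  have ha : a.IsRightAdjoint := inferInstance
  have he : e.IsEquivalence := inferInstance
  let i : a ⋙ e.inv ≅ etalePushforward f :=
    show (etalePushforward f ⋙ e) ⋙ e.inv ≅ _ from
      Functor.associator _ _ _ ≪≫
        Functor.isoWhiskerLeft (etalePushforward f) e.asEquivalence.unitIso.symm ≪≫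
          Functor.rightUnitor _
  have : (a ⋙ e.inv).IsRightAdjoint := inferInstance
  exact Functor.isRightAdjoint_of_iso i

/-- The fibre of `V ×[X] Y` at a geometric point `y` of `Y` is the fibre of `V` at the image of `y`
in `X`. -/
def fiberIso {Ω : Type u} [Field Ω] [IsSepClosed Ω] (y : Spec (.of Ω) ⟶ Y) :
    etalePullback f ⋙ (pointSmallEtale y).fiber ≅ (pointSmallEtale (y ≫ f)).fiber :=
  show Etale.forget X ⋙ (Over.pullback f ⋙ coyoneda.obj (op (Over.mk y))) ≅
    Etale.forget X ⋙ coyoneda.obj (op ((Over.map f).obj (Over.mk y))) from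
  Functor.isoWhiskerLeft (Etale.forget X) (NatIso.ofComponents (fun V ↦
    ((Over.mapPullbackAdj f).homEquiv (Over.mk y) V).symm.toIso) (by
      intro V W g
      ext x
      exact (Over.mapPullbackAdj f).homEquiv_naturality_right_symm _ _))

instance initiallySmall_elements {Ω : Type u} [Field Ω] [IsSepClosed Ω] (y : Spec (.of Ω) ⟶ Y) :
    InitiallySmall.{u} (etalePullback f ⋙ (pointSmallEtale y).fiber).Elements := by
  have : InitiallySmall.{u} (Functor.elementsFunctor.obj (pointSmallEtale (y ≫ f)).fiber) :=
    (pointSmallEtale (y ≫ f)).initiallySmall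
  let e : (etalePullback f ⋙ (pointSmallEtale y).fiber).Elements ≌
      (pointSmallEtale (y ≫ f)).fiber.Elements :=
    Cat.equivOfIso (Functor.elementsFunctor.mapIso (fiberIso f y))
  exact initiallySmall_of_initial_of_initiallySmall e.inverse

/-- The pullback of étale sheaves along `f : Y ⟶ X`: the left adjoint of the pushforward. -/
abbrev etaleSheafPullback : EtaleSheaf X ⥤ EtaleSheaf Y :=
  (etalePullback f).sheafPullback (Type u) X.smallEtaleTopology Y.smallEtaleTopology

lemma preservesFiniteLimits_etaleSheafPullback :
    PreservesFiniteLimits (etaleSheafPullback f) where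
  preservesFiniteLimits J _ _ := ⟨fun {K} ↦ ⟨fun {c} hc ↦ by
    have H := (isConservativeFamilyOfPoints_pointSmallEtale' Y).jointlyReflectIsomorphisms (Type u)
    refine ⟨H.jointlyReflectsLimit ?_⟩
    intro ⟨P, hP⟩
    refine Nonempty.some ?_
    obtain ⟨y⟩ := hP
    let s := (SpecToEquivOfField (SeparableClosure (Y.residueField y)) Y).invFun
      ⟨y, CommRingCat.ofHom (algebraMap (Y.residueField y) (SeparableClosure (Y.residueField y)))⟩
    change Nonempty (IsLimit ((pointSmallEtale s).sheafFiber.mapCone _))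
    have : PreservesFiniteLimits (etaleSheafPullback f ⋙ (pointSmallEtale s).sheafFiber) :=
      preservesFiniteLimits_of_natIso ((pointSmallEtale s).sheafFiberComapIso (etalePullback f)
        (coverPreserving_etalePullback f) (Type u))
    exact ⟨isLimitOfPreserves (etaleSheafPullback f ⋙ (pointSmallEtale s).sheafFiber) hc⟩⟩⟩

/-- The morphism of étale topoi induced by a morphism of schemes `f : Y ⟶ X`. -/
def etaleGeometricMorphism : Topoi.GeometricMorphism (EtaleSheaf Y) (EtaleSheaf X) where
  pushforward := etalePushforward f
  pullback := etaleSheafPullback f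
  adj := (etalePullback f).sheafAdjunctionContinuous (Type u) X.smallEtaleTopology
    Y.smallEtaleTopology
  preservesFiniteLimits_pullback := preservesFiniteLimits_etaleSheafPullback f

/-- A scheme is normal if all its local rings are integrally closed domains. -/
class IsNormalScheme (X : Scheme.{u}) : Prop where
  isDomain_stalk : ∀ x : X, IsDomain (X.presheaf.stalk x)
  isIntegrallyClosed_stalk : ∀ x : X, IsIntegrallyClosed (X.presheaf.stalk x)

/-- A morphism that is finitely presented, separated and étale. (Étale morphisms are locally of
finite presentation; together with quasi-compact and separated this is finite presentation.) -/
structure IsEtaleFPS {V X : Scheme.{u}} (g : V ⟶ X) : Prop where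
  etale : Etale g
  quasiCompact : QuasiCompact g
  isSeparated : IsSeparated g

/-- For every finitely presented, separated, étale `V ⟶ X`, the projection `V ×[X] Y ⟶ V` induces a
bijection on connected components. -/
def PullbackPreservesPiZero : Prop :=
  ∀ (V : Scheme.{u}) (g : V ⟶ X), IsEtaleFPS g →
    Function.Bijective (pullback.fst g f).continuous.connectedComponentsMap

/-- The generic fibre of `f` is geometrically connected over the residue field of the generic point
of `X`. -/
def GeometricallyConnectedGenericFibre [IrreducibleSpace X] : Prop :=
  GeometricallyConnected (f.fiberToSpecResidueField (genericPoint X))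

lemma map_genericPoint [IrreducibleSpace X] [IrreducibleSpace Y] [IsDominant f] :
    f (genericPoint Y) = genericPoint X := by
  have h := (genericPoint_spec Y).image f.continuous
  rw [Set.image_univ, f.denseRange.closure_range] at h
  exact h.eq (genericPoint_spec X)

/-- The map of function fields `K(X) ⟶ K(Y)` induced by a dominant morphism `f : Y ⟶ X`. -/
def functionFieldMap [IrreducibleSpace X] [IrreducibleSpace Y] [IsDominant f] :
    X.functionField ⟶ Y.functionField :=
  X.presheaf.stalkSpecializes (specializes_of_eq (map_genericPoint f)) ≫
    f.stalkMap (genericPoint Y)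

/-- A field extension `L / K` is primary if every element of `L` that is separable algebraic over
`K` lies in `K`. -/
def IsPrimaryExtension (K : Type u₁) (L : Type u₂) [Field K] [Field L] [Algebra K L] : Prop :=
  separableClosure K L = ⊥

/-- The extension of function fields `K(X) ⟶ K(Y)` is primary. -/
def IsPrimaryOnFunctionFields [AlgebraicGeometry.IsIntegral X] [AlgebraicGeometry.IsIntegral Y] [IsDominant f] : Prop :=
  letI : Algebra X.functionField Y.functionField := (functionFieldMap f).hom.toAlgebra
  IsPrimaryExtension X.functionField Y.functionField

end EtaleTopos

end

/-!
Let `Ω` denote the coproduct of two copies of the terminal object of a topos. Topoi are finitary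
extensive, so the decompositions of `U` are classified by the maps `U ⟶ Ω`
(`Decomposition.same_iff_char_eq`, `Decomposition.exists_char_eq`). By adjunction, the decompositions
of `f^*U` are classified by the maps `U ⟶ f_*Ω`, and pullback of decompositions is composition with
the comparison map `θ : Ω ⟶ f_*Ω`. Hence unique descent of decompositions for all `U`, or for `U` in a
set of generators, says that `θ` is an isomorphism. Conversely if `θ` is an isomorphism, then `f_*`
preserves all binary coproducts `A ⨿ B`, since these are the pullbacks of `Ω` along their classifying
maps and `f_*` preserves pullbacks; and it preserves the initial object, which is the intersection
of the two summands of `Ω`.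

In the étale topos of a scheme, `Ω` is the sheaf `V ↦ C(V, Bool)` of clopen subsets. So `f_*`
preserves finite coproducts if and only if `V` and `V ×[X] Y` have the same clopen subsets for all
étale `V ⟶ X` (`preservesFiniteCoproducts_pushforward_iff`). This property, and its variant for
connected components, is compared with the generic fibre through one fact on normality: a scheme
étale over a normal integral scheme is covered by open subsets with at most one point over the
generic point (`exists_open_forall_eq_of_etale`). It holds because idempotents of the generic
fibre of an étale algebra over an integrally closed domain are integral, and thus defined over the
algebra itself.

* If the generic fibre is geometrically connected, let `W ⊆ V` be an open subset with at most one
  point `w` over the generic point of `X`. The preimage of `W` in `V ×[X] Y` is connected, as it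
  contains the connected fibre over `w` as a dense subset. Clopen subsets and connected components
  of `V ×[X] Y` therefore descend to `V`.
* If clopen subsets or connected components are preserved, let `α` in `K(Y)` be separable over
  `K(X)`. It defines an irreducible étale `V ⟶ X` with a `K(Y)`-valued point. Then `V ×[X] Y` is
  connected and étale over `Y`, hence has a single point over the generic point of `Y`; its generic
  fibre has a rational point and so is the spectrum of `K(Y)`. Thus `α` equals all its conjugates
  and lies in `K(X)` (`exists_algebraMap_eq_of_isSeparable_of_forall_preconnectedSpace`).
* If `K(Y)` is primary over `K(X)`, let `∑ bᵢ ⊗ xᵢ` be an idempotent of `L ⊗ K(Y)` for a field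
  extension `L` of `K(X)`, where the `bᵢ` are linearly independent. Derivations kill idempotents, so
  the `xᵢ` generate an unramified extension of `K(X)`. They are separable, lie in `K(X)`, and the
  idempotent lies in `L`. So the spectrum of `L ⊗ K(Y)` is connected, and its image is dense in the
  base change of the generic fibre to `L`.
-/

namespace Topoi

/-! ### Exactness properties of topoi -/

section IsTopos

variable (E : Type u₁) [Category.{v₁} E] [IsTopos.{w} E]

lemma IsTopos.hasFiniteLimits : HasFiniteLimits E := by
  obtain ⟨C, _, J, ⟨e⟩⟩ := IsTopos.exists_site.{w} (E := E)
  exact hasFiniteLimits_of_hasLimitsLimits_of_createsFiniteLimits e.functor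

lemma IsTopos.finitaryExtensive : FinitaryExtensive E := by
  obtain ⟨C, _, J, ⟨e⟩⟩ := IsTopos.exists_site.{w} (E := E)
  have := IsTopos.hasFiniteLimits.{w} E
  have h : HasFiniteCoproducts (Sheaf J (Type w)) := FinitaryExtensive.hasFiniteCoproducts
  have : HasFiniteCoproducts E :=
    ⟨fun n ↦ have := h.out n; Adjunction.hasColimitsOfShape_of_equivalence e.functor⟩
  exact finitaryExtensive_of_preserves_and_reflects_isomorphism e.functor

lemma IsTopos.balanced : Balanced E := by
  obtain ⟨C, _, J, ⟨e⟩⟩ := IsTopos.exists_site.{w} (E := E)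
  exact e.functor.balanced_of_preserves

end IsTopos

/-! ### Decompositions are classified by maps to the coproduct of two terminal objects -/

namespace Decomposition

variable {C : Type u₁} [Category.{v₁} C] {T Ω : C} (hT : IsTerminal T) (i₀ i₁ : T ⟶ Ω)

/-- The classifying map `U ⟶ T ⨿ T` of a decomposition of `U`, where `T` is terminal. -/
noncomputable def char {U : C} (D : Decomposition U) : U ⟶ Ω :=
  D.isColimit.desc (BinaryCofan.mk (hT.from _ ≫ i₀) (hT.from _ ≫ i₁))

lemma inl_char {U : C} (D : Decomposition U) : D.inl ≫ D.char hT i₀ i₁ = hT.from _ ≫ i₀ :=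
  D.isColimit.fac _ ⟨.left⟩

lemma inr_char {U : C} (D : Decomposition U) : D.inr ≫ D.char hT i₀ i₁ = hT.from _ ≫ i₁ :=
  D.isColimit.fac _ ⟨.right⟩

lemma hom_ext {U Z : C} (D : Decomposition U) {f g : U ⟶ Z} (hl : D.inl ≫ f = D.inl ≫ g)
    (hr : D.inr ≫ f = D.inr ≫ g) : f = g :=
  BinaryCofan.IsColimit.hom_ext D.isColimit hl hr

variable [FinitaryExtensive C] {i₀ i₁} (hΩ : IsColimit (BinaryCofan.mk i₀ i₁))

include hΩ

/-- The summands of a decomposition are the pullbacks of the summands of `Ω` along the classifying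
map. -/
lemma isPullback_char {U : C} (D : Decomposition U) :
    IsPullback D.inl (hT.from _) (D.char hT i₀ i₁) i₀ ∧
      IsPullback D.inr (hT.from _) (D.char hT i₀ i₁) i₁ :=
  ((BinaryCofan.isVanKampen_iff _).1 (FinitaryExtensive.vanKampen _ hΩ)
    (BinaryCofan.mk D.inl D.inr) (hT.from _) (hT.from _) (D.char hT i₀ i₁)
    (D.inl_char hT i₀ i₁).symm (D.inr_char hT i₀ i₁).symm).1 ⟨D.isColimit⟩

lemma same_iff_char_eq {U : C} (D E : Decomposition U) :
    D.Same E ↔ D.char hT i₀ i₁ = E.char hT i₀ i₁ := by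
  refine ⟨fun ⟨⟨e, he⟩, ⟨e', he'⟩⟩ ↦ D.hom_ext ?_ ?_, fun h ↦ ⟨?_, ?_⟩⟩
  · rw [inl_char, ← he, Category.assoc, inl_char, ← Category.assoc]
    congr 1
    exact hT.hom_ext _ _
  · rw [inr_char, ← he', Category.assoc, inr_char, ← Category.assoc]
    congr 1
    exact hT.hom_ext _ _
  · have hD := (D.isPullback_char hT hΩ).1
    rw [h] at hD
    exact ⟨hD.isoIsPullback _ _ (E.isPullback_char hT hΩ).1, hD.isoIsPullback_hom_fst _ _ _⟩
  · have hD := (D.isPullback_char hT hΩ).2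
    rw [h] at hD
    exact ⟨hD.isoIsPullback _ _ (E.isPullback_char hT hΩ).2, hD.isoIsPullback_hom_fst _ _ _⟩

/-- Every map to `Ω` classifies a decomposition, formed by the pullbacks of the two summands. -/
lemma exists_char_eq [HasPullbacks C] {U : C} (χ : U ⟶ Ω) :
    ∃ D : Decomposition U, D.char hT i₀ i₁ = χ := by
  obtain ⟨hc⟩ := ((BinaryCofan.isVanKampen_iff _).1 (FinitaryExtensive.vanKampen _ hΩ)
    (BinaryCofan.mk (pullback.fst χ i₀) (pullback.fst χ i₁)) (pullback.snd χ i₀)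
    (pullback.snd χ i₁) χ pullback.condition.symm pullback.condition.symm).2
    ⟨IsPullback.of_hasPullback χ i₀, IsPullback.of_hasPullback χ i₁⟩
  let D : Decomposition U := ⟨_, _, _, _, hc⟩
  refine ⟨D, D.hom_ext ?_ ?_⟩
  · rw [inl_char]
    exact (congr_arg (· ≫ i₀) (hT.hom_ext _ _)).trans pullback.condition.symm
  · rw [inr_char]
    exact (congr_arg (· ≫ i₁) (hT.hom_ext _ _)).trans pullback.condition.symm

end Decomposition

/-! ### Pushforwards and finite coproducts -/

namespace GeometricMorphism

variable {𝒴 : Type u₁} [Category.{v₁} 𝒴] {𝒳 : Type u₂} [Category.{v₂} 𝒳]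
  (f : GeometricMorphism 𝒴 𝒳) {T' Ω' : 𝒴} (hT' : IsTerminal T') {j₀ j₁ : T' ⟶ Ω'}
  {T Ω : 𝒳} (hT : IsTerminal T) {i₀ i₁ : T ⟶ Ω}
  {t : T ⟶ f.pushforward.obj T'} {θ : Ω ⟶ f.pushforward.obj Ω'}
  (h₀ : i₀ ≫ θ = t ≫ f.pushforward.map j₀) (h₁ : i₁ ≫ θ = t ≫ f.pushforward.map j₁)

/-- The pushforward of a terminal object is terminal. -/
noncomputable def isTerminalPushforward : IsTerminal (f.pushforward.obj T') :=
  haveI := f.adj.rightAdjoint_preservesLimits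
  IsTerminal.isTerminalObj f.pushforward T' hT'

include h₀ h₁ in
/-- Pulling back a decomposition composes its classifying map with the comparison map `θ`, under the
identification of maps `f^*U ⟶ Ω'` with maps `U ⟶ f_*Ω'`. -/
lemma homEquiv_char_pullbackDecomposition {U : 𝒳} (E : Decomposition U) :
    f.adj.homEquiv _ _ ((f.pullbackDecomposition E).char hT' j₀ j₁) = E.char hT i₀ i₁ ≫ θ := by
  refine E.hom_ext ?_ ?_
  · rw [← f.adj.homEquiv_naturality_left, reassoc_of% E.inl_char hT, h₀]
    refine (congr_arg _ ((f.pullbackDecomposition E).inl_char hT' j₀ j₁)).trans ?_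
    change f.adj.homEquiv _ _ (hT'.from (f.pullback.obj E.left) ≫ j₀) = _
    rw [f.adj.homEquiv_naturality_right, ← Category.assoc]
    exact congr_arg (· ≫ _) ((f.isTerminalPushforward hT').hom_ext _ _)
  · rw [← f.adj.homEquiv_naturality_left, reassoc_of% E.inr_char hT, h₁]
    refine (congr_arg _ ((f.pullbackDecomposition E).inr_char hT' j₀ j₁)).trans ?_
    change f.adj.homEquiv _ _ (hT'.from (f.pullback.obj E.right) ≫ j₁) = _
    rw [f.adj.homEquiv_naturality_right, ← Category.assoc]
    exact congr_arg (· ≫ _) ((f.isTerminalPushforward hT').hom_ext _ _)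

variable [FinitaryExtensive 𝒳] [FinitaryExtensive 𝒴]
  (hΩ' : IsColimit (BinaryCofan.mk j₀ j₁)) (hΩ : IsColimit (BinaryCofan.mk i₀ i₁))

include h₀ h₁ hT' hT hΩ' hΩ

/-- The decompositions of `U` are the maps `U ⟶ Ω`, and those of `f^*U` are the maps
`f^*U ⟶ Ω'`, that is, the maps `U ⟶ f_*Ω'`. -/
lemma decompositionsDescendUniquely_iff [HasPullbacks 𝒳] [HasPullbacks 𝒴] (U : 𝒳) :
    f.DecompositionsDescendUniquely U ↔ Function.Bijective (fun χ : U ⟶ Ω ↦ χ ≫ θ) := by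
  have key (E : Decomposition U) (D : Decomposition (f.pullback.obj U)) :
      (f.pullbackDecomposition E).Same D ↔
        E.char hT i₀ i₁ ≫ θ = f.adj.homEquiv _ _ (D.char hT' j₀ j₁) := by
    rw [Decomposition.same_iff_char_eq hT' hΩ', ← (f.adj.homEquiv _ _).apply_eq_iff_eq,
      f.homEquiv_char_pullbackDecomposition hT' hT h₀ h₁]
  rw [Function.bijective_iff_existsUnique]
  constructor
  · intro H φ
    obtain ⟨D, hD⟩ := Decomposition.exists_char_eq hT' hΩ' ((f.adj.homEquiv _ _).symm φ)
    obtain ⟨E, hE, hE'⟩ := H D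
    refine ⟨E.char hT i₀ i₁, by simpa [hD] using (key E D).1 hE, fun χ hχ ↦ ?_⟩
    obtain ⟨E', rfl⟩ := Decomposition.exists_char_eq hT hΩ χ
    exact (Decomposition.same_iff_char_eq hT hΩ _ _).1 (hE' E' ((key E' D).2 (by simpa [hD])))
  · intro H D
    obtain ⟨χ, hχ, hχ'⟩ := H (f.adj.homEquiv _ _ (D.char hT' j₀ j₁))
    obtain ⟨E, rfl⟩ := Decomposition.exists_char_eq hT hΩ χ
    exact ⟨E, (key E D).2 hχ, fun E' hE' ↦
      (Decomposition.same_iff_char_eq hT hΩ _ _).2 (hχ' _ ((key E' D).1 hE'))⟩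

omit [FinitaryExtensive 𝒳] [FinitaryExtensive 𝒴] in
lemma isIso_of_preservesFiniteCoproducts [PreservesFiniteCoproducts f.pushforward] :
    IsIso θ := by
  have : IsIso t := ⟨hT.from _, hT.hom_ext _ _, (f.isTerminalPushforward hT').hom_ext _ _⟩
  have hc := mapIsColimitOfPreservesOfIsColimit f.pushforward j₀ j₁ hΩ'
  have hc' : IsColimit (BinaryCofan.mk (i₀ ≫ θ) (i₁ ≫ θ)) := by
    rw [h₀, h₁]
    exact BinaryCofan.isColimitCompLeftIso _ t (BinaryCofan.isColimitCompRightIso _ t hc)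
  have : θ = (hΩ.coconePointUniqueUpToIso hc').hom :=
    BinaryCofan.IsColimit.hom_ext hΩ (hΩ.comp_coconePointUniqueUpToIso_hom hc' ⟨.left⟩).symm
      (hΩ.comp_coconePointUniqueUpToIso_hom hc' ⟨.right⟩).symm
  rw [this]
  exact Iso.isIso_hom _

/-- If `θ` is an isomorphism, then `f_*` preserves the coproduct `Ω'` of two terminal objects. By
extensivity, other binary coproducts and the initial object are pullbacks of `Ω'` and its summands,
and `f_*` preserves pullbacks. -/
lemma preservesFiniteCoproducts_of_isIso [IsIso θ] :
    PreservesFiniteCoproducts f.pushforward := by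
  have : PreservesLimits f.pushforward := f.adj.rightAdjoint_preservesLimits
  have : IsIso t := ⟨hT.from _, hT.hom_ext _ _, (f.isTerminalPushforward hT').hom_ext _ _⟩
  have hc : IsColimit (BinaryCofan.mk (f.pushforward.map j₀) (f.pushforward.map j₁)) := by
    have h₀' : inv t ≫ i₀ ≫ θ = f.pushforward.map j₀ := by simp [h₀]
    have h₁' : inv t ≫ i₁ ≫ θ = f.pushforward.map j₁ := by simp [h₁]
    have hc₀ : IsColimit (BinaryCofan.mk (i₀ ≫ θ) (i₁ ≫ θ)) :=
      hΩ.ofIsoColimit (BinaryCofan.ext (@asIso _ _ _ _ θ ‹_›) rfl rfl)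
    rw [← h₀', ← h₁']
    exact BinaryCofan.isColimitCompLeftIso _ (inv t)
      (BinaryCofan.isColimitCompRightIso _ (inv t) hc₀)
  have hbin : PreservesColimitsOfShape (Discrete WalkingPair) f.pushforward := by
    have (A B : 𝒴) : PreservesColimit (pair A B) f.pushforward := by
      refine preservesColimit_of_preserves_colimit_cocone (coprodIsCoprod A B) ?_
      refine (isColimitMapCoconeBinaryCofanEquiv _ _ _).symm ?_
      let D : Decomposition (A ⨿ B) := ⟨A, B, coprod.inl, coprod.inr, coprodIsCoprod A B⟩
      obtain ⟨h, h'⟩ := D.isPullback_char hT' hΩ'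
      exact (((BinaryCofan.isVanKampen_iff _).1 (FinitaryExtensive.vanKampen _ hc)
        (BinaryCofan.mk _ _) _ _ _ (h.map f.pushforward).w.symm
        (h'.map f.pushforward).w.symm).2 ⟨h.map f.pushforward, h'.map f.pushforward⟩).some
    exact ⟨fun {K} ↦ preservesColimit_of_iso_diagram _ (diagramIsoPair K).symm⟩
  have hini : PreservesColimitsOfShape (Discrete PEmpty.{1}) f.pushforward := by
    have h₁ := (FinitaryExtensive.isPullback_initial_to_binaryCofan hΩ').map f.pushforward
    have h₂ := FinitaryExtensive.isPullback_initial_to_binaryCofan hc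
    have : IsInitial (f.pushforward.obj (⊥_ 𝒴)) :=
      initialIsInitial.ofIso (h₂.isoIsPullback _ _ h₁)
    have : PreservesColimit (Functor.empty.{0} 𝒴) f.pushforward :=
      preservesInitial_of_iso f.pushforward (initialIsInitial.uniqueUpToIso this)
    exact preservesColimitsOfShape_pempty_of_preservesInitial _
  exact ⟨fun n ↦ PreservesFiniteCoproducts.of_preserves_binary_and_initial _ _⟩

lemma preservesFiniteCoproducts_iff_isIso :
    PreservesFiniteCoproducts f.pushforward ↔ IsIso θ :=
  ⟨fun _ ↦ f.isIso_of_preservesFiniteCoproducts hT' hT h₀ h₁ hΩ' hΩ,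
    fun _ ↦ f.preservesFiniteCoproducts_of_isIso hT' hT h₀ h₁ hΩ' hΩ⟩

end GeometricMorphism

/-- The equivalence of the first three conditions for a geometric morphism of topoi. Generators detect
isomorphisms since topoi are balanced, which yields the passage from generators to all objects. -/
theorem tfae_preservesFiniteCoproducts_pushforward
    {𝒴 : Type u₁} [Category.{v₁} 𝒴] [IsTopos.{w} 𝒴] {𝒳 : Type u₂} [Category.{v₂} 𝒳]
    [IsTopos.{w} 𝒳] (f : GeometricMorphism 𝒴 𝒳) (𝒳₀ : ObjectProperty 𝒳)
    (h𝒳₀ : 𝒳₀.IsSeparating) :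
    List.TFAE [
      PreservesFiniteCoproducts f.pushforward,
      ∀ U : 𝒳, f.DecompositionsDescendUniquely U,
      ∀ U : 𝒳, 𝒳₀ U → f.DecompositionsDescendUniquely U] := by
  have := IsTopos.hasFiniteLimits.{w} 𝒳
  have := IsTopos.hasFiniteLimits.{w} 𝒴
  have := IsTopos.finitaryExtensive.{w} 𝒳
  have := IsTopos.finitaryExtensive.{w} 𝒴
  have := IsTopos.balanced.{w} 𝒳
  let hΩ := coprodIsCoprod (⊤_ 𝒳) (⊤_ 𝒳)
  let hΩ' := coprodIsCoprod (⊤_ 𝒴) (⊤_ 𝒴)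
  let t : ⊤_ 𝒳 ⟶ f.pushforward.obj (⊤_ 𝒴) := (f.isTerminalPushforward terminalIsTerminal).from _
  let θ : (⊤_ 𝒳) ⨿ (⊤_ 𝒳) ⟶ f.pushforward.obj ((⊤_ 𝒴) ⨿ (⊤_ 𝒴)) :=
    coprod.desc (t ≫ f.pushforward.map coprod.inl) (t ≫ f.pushforward.map coprod.inr)
  have h₀ : coprod.inl ≫ θ = t ≫ f.pushforward.map coprod.inl := coprod.inl_desc _ _
  have h₁ : coprod.inr ≫ θ = t ≫ f.pushforward.map coprod.inr := coprod.inr_desc _ _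
  rw [f.preservesFiniteCoproducts_iff_isIso terminalIsTerminal terminalIsTerminal h₀ h₁ hΩ' hΩ]
  simp only [f.decompositionsDescendUniquely_iff terminalIsTerminal terminalIsTerminal h₀ h₁ hΩ' hΩ]
  tfae_have 1 → 2 := fun _ U ↦
    ⟨fun a b h ↦ (cancel_mono θ).1 h, fun φ ↦ ⟨φ ≫ inv θ, by simp⟩⟩
  tfae_have 2 → 3 := fun h U _ ↦ h U
  tfae_have 3 → 1 := fun h ↦ h𝒳₀.isDetecting θ fun G hG φ ↦
    (Function.bijective_iff_existsUnique _).1 (h G hG) φ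
  tfae_finish

end Topoi

namespace EtaleTopos

open Scheme

/-! ### Clopen subsets and the étale sheaf `1 ⨿ 1` -/

section ClopenSheaf

variable (X : Scheme.{u})

instance isContinuous_etaleForget :
    (Etale.forget X).IsContinuous X.smallEtaleTopology (Scheme.etaleTopology.over X) :=
  have : RepresentablyFlat (Etale.forget X) := flat_of_preservesFiniteLimits _
  have : etaleMorphisms.{u}.IsMultiplicative :=
    inferInstanceAs (MorphismProperty.IsMultiplicative @Etale.{u})
  Functor.isContinuous_of_coverPreserving (compatiblePreservingOfFlat _ _)
    ((MorphismProperty.Over.forget etaleMorphisms ⊤ X).coverPreserving_restrictedTopology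
      (X.overGrothendieckTopology etaleMorphisms))

instance isContinuous_etaleForget_comp_forget :
    (Etale.forget X ⋙ Over.forget X).IsContinuous X.smallEtaleTopology Scheme.etaleTopology :=
  Functor.isContinuous_comp _ _ _ (Scheme.etaleTopology.over X) _

/-- The étale sheaf `V ↦ C(V, Bool)`, whose sections over `V` are the clopen subsets of `V`. -/
noncomputable def clopenSheaf : EtaleSheaf X where
  obj := (Etale.forget X ⋙ Over.forget X).op ⋙ continuousMapPresheaf Bool
  property := Functor.op_comp_isSheaf_of_isSheaf _ _ Scheme.etaleTopology _
    (.of_le (etaleTopology_le_proetaleTopology.trans proetaleTopology_le_fpqcTopology)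
      (isSheaf_fpqcTopology_continuousMapPresheaf Bool))

/-- The étale sheaf with a single section over every object. -/
noncomputable def pointSheaf : EtaleSheaf X where
  obj := (Functor.const _).obj PUnit
  property := Presheaf.isSheaf_of_isTerminal _ Types.isTerminalPUnit

/-- The sheaf with a single section over every object is terminal. -/
noncomputable def isTerminalPointSheaf : IsTerminal (pointSheaf X) :=
  .ofUniqueHom (fun F ↦ ⟨{ app := fun V ↦ ↾fun _ ↦ PUnit.unit }⟩) (fun F m ↦ by
    ext; rfl)

/-- The constant sections `false` and `true` of the sheaf of clopen subsets. -/
noncomputable def clopenSheafConst (b : Bool) : pointSheaf X ⟶ clopenSheaf X :=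
  ⟨{ app := fun V ↦ ↾fun _ ↦ ContinuousMap.const V.unop.left b }⟩

/-- The map of presheaves from the constant presheaf with value `Bool` to the sheaf of clopen
subsets. -/
noncomputable def constToClopenSheaf :
    (Functor.const X.Etaleᵒᵖ).obj (ULift.{u} Bool) ⟶ (clopenSheaf X).obj where
  app V := ↾fun b ↦ ContinuousMap.const V.unop.left b.down

variable {X}

/-- An open subscheme of an étale `X`-scheme, as an étale `X`-scheme. -/
noncomputable def etaleOpen (V : X.Etale) (U : V.left.Opens) : X.Etale :=
  MorphismProperty.Over.mk ⊤ (U.ι ≫ V.hom) (by have := V.prop; exact inferInstanceAs (Etale _))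

/-- The inclusion of an open subscheme of an étale `X`-scheme. -/
noncomputable def etaleOpenι (V : X.Etale) (U : V.left.Opens) : etaleOpen V U ⟶ V :=
  MorphismProperty.Over.homMk U.ι rfl

variable (X)

instance isLocallyInjective_constToClopenSheaf :
    Presheaf.IsLocallyInjective X.smallEtaleTopology (constToClopenSheaf X) where
  equalizerSieve_mem {V} a b hab := by
    by_cases h : IsEmpty V.unop.left
    · -- The empty sieve covers the empty scheme.
      refine X.smallEtaleTopology.superset_covering bot_le ?_
      have := (ofArrows_mem_smallEtaleTopology_iff (X := X) (W := V.unop) (ι := PEmpty.{1})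
        (Z := PEmpty.elim) (fun i ↦ i.elim)).2 (Set.ext fun x ↦ h.elim x)
      refine X.smallEtaleTopology.superset_covering ?_ this
      rintro W g ⟨_, _, _, ⟨i⟩, _⟩
      exact i.elim
    · obtain ⟨x⟩ := not_isEmpty_iff.1 h
      have : a = b :=
        ULift.ext _ _ (congr_arg (fun c : C(V.unop.left, Bool) ↦ c x) hab : a.down = b.down)
      subst this
      simp

instance isLocallySurjective_constToClopenSheaf :
    Presheaf.IsLocallySurjective X.smallEtaleTopology (constToClopenSheaf X) where
  imageSieve_mem {V} s := by
    let s' : C(V.left, Bool) := s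
    let U (b : Bool) : V.left.Opens := ⟨s' ⁻¹' {b}, (isOpen_discrete _).preimage s'.continuous⟩
    have := (ofArrows_mem_smallEtaleTopology_iff (fun b ↦ etaleOpenι V (U b))).2 (by
      ext x
      simp only [Set.mem_iUnion, Set.mem_univ, iff_true]
      exact ⟨s' x, (Scheme.Opens.range_ι (U (s' x))).ge rfl⟩)
    refine X.smallEtaleTopology.superset_covering ?_ this
    rintro W _ ⟨_, g, _, ⟨b⟩, rfl⟩
    have hb : s'.comp (etaleOpenι V (U b)).left.base.hom = ContinuousMap.const _ b := by
      ext x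
      exact (Scheme.Opens.range_ι (U b)).le ⟨x, rfl⟩
    refine ⟨⟨b⟩, ?_⟩
    change ContinuousMap.const _ b = s'.comp (g ≫ etaleOpenι V (U b)).left.base.hom
    exact congr_arg (fun c : C((etaleOpen V (U b)).left, Bool) ↦ c.comp g.left.base.hom) hb.symm

/-- The sheaf of clopen subsets is the sheafification of the constant presheaf with value `Bool`. -/
lemma w_constToClopenSheaf : X.smallEtaleTopology.W (constToClopenSheaf X) :=
  (X.smallEtaleTopology.W_iff_isLocallyBijective _).2 ⟨inferInstance, inferInstance⟩

/-- The sheaf of clopen subsets is the coproduct of two copies of the terminal sheaf. -/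
noncomputable def isColimitClopenSheaf :
    IsColimit (BinaryCofan.mk (clopenSheafConst X false) (clopenSheafConst X true)) := by
  have hW (F : EtaleSheaf X) := w_constToClopenSheaf X F.obj F.property
  let glue {F : EtaleSheaf X} (a b : pointSheaf X ⟶ F) :
      (Functor.const X.Etaleᵒᵖ).obj (ULift.{u} Bool) ⟶ F.obj :=
    { app := fun V ↦ ↾fun c ↦ bif c.down then b.hom.app V PUnit.unit else a.hom.app V PUnit.unit
      naturality := fun V W g ↦ by
        ext ⟨_ | _⟩
        · exact NatTrans.naturality_apply a.hom g PUnit.unit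
        · exact NatTrans.naturality_apply b.hom g PUnit.unit }
  have hglue {F : EtaleSheaf X} (a b : pointSheaf X ⟶ F) (m : clopenSheaf X ⟶ F) :
      constToClopenSheaf X ≫ m.hom = glue a b ↔
        clopenSheafConst X false ≫ m = a ∧ clopenSheafConst X true ≫ m = b := by
    refine ⟨fun h ↦ ⟨?_, ?_⟩, ?_⟩
    · ext V x
      exact ConcreteCategory.congr_hom (NatTrans.congr_app h V) ⟨false⟩
    · ext V x
      exact ConcreteCategory.congr_hom (NatTrans.congr_app h V) ⟨true⟩
    · rintro ⟨rfl, rfl⟩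
      ext V ⟨_ | _⟩ <;> rfl
  refine BinaryCofan.IsColimit.mk _ (fun {F} a b ↦ ⟨((hW F).2 (glue a b)).choose⟩) ?_ ?_ ?_
  · exact fun {F} a b ↦ ((hglue a b _).1 ((hW F).2 (glue a b)).choose_spec).1
  · exact fun {F} a b ↦ ((hglue a b _).1 ((hW F).2 (glue a b)).choose_spec).2
  · intro F a b m h₁ h₂
    ext1
    exact (hW F).1 (((hglue a b m).2 ⟨h₁, h₂⟩).trans ((hW F).2 (glue a b)).choose_spec.symm)

end ClopenSheaf

section Comparison

variable {X Y : Scheme.{u}} (f : Y ⟶ X)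

/-- The map `C(V, Bool) → C(V ×[X] Y, Bool)` given by pulling back clopen subsets. -/
noncomputable def clopenSheafComparison :
    clopenSheaf X ⟶ (etalePushforward f).obj (clopenSheaf Y) :=
  ⟨{ app := fun V ↦ ↾fun c ↦ ContinuousMap.comp c (pullback.fst V.unop.hom f).base.hom
     naturality := fun V W g ↦ by
      ext c
      have hg : ((etalePullback f).map g.unop).left ≫ pullback.fst V.unop.hom f =
          pullback.fst W.unop.hom f ≫ g.unop.left := pullback.lift_fst _ _ _
      exact congr_arg (fun p : ((etalePullback f).obj W.unop).left ⟶ V.unop.left ↦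
        ContinuousMap.comp (c : C(V.unop.left, Bool)) p.base.hom)
        hg.symm }⟩

/-- Pulling back clopen subsets along `V ×[X] Y ⟶ V` is bijective for all étale `V ⟶ X`. -/
def PullbackPreservesClopens : Prop :=
  ∀ (V : Scheme.{u}) (g : V ⟶ X), Etale g →
    Function.Bijective fun c : C(V, Bool) ↦ c.comp (pullback.fst g f).base.hom

lemma isIso_clopenSheafComparison_iff :
    IsIso (clopenSheafComparison f) ↔ PullbackPreservesClopens f := by
  rw [← isIso_iff_of_reflects_iso _ (sheafToPresheaf _ _), NatTrans.isIso_iff_isIso_app]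
  simp only [isIso_iff_bijective]
  exact ⟨fun h V g hg ↦ h (op (Etale.mk g)), fun h V ↦ h V.unop.left V.unop.hom V.unop.prop⟩

lemma preservesFiniteCoproducts_pushforward_iff :
    PreservesFiniteCoproducts (etaleGeometricMorphism f).pushforward ↔
      PullbackPreservesClopens f := by
  have := Topoi.IsTopos.finitaryExtensive.{u} (EtaleSheaf X)
  have := Topoi.IsTopos.finitaryExtensive.{u} (EtaleSheaf Y)
  rw [← isIso_clopenSheafComparison_iff]
  let t : pointSheaf X ⟶ (etalePushforward f).obj (pointSheaf Y) :=
    ⟨{ app := fun V ↦ ↾fun _ ↦ PUnit.unit }⟩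
  exact (etaleGeometricMorphism f).preservesFiniteCoproducts_iff_isIso
    (isTerminalPointSheaf Y) (isTerminalPointSheaf X) (t := t) (θ := clopenSheafComparison f)
    rfl rfl (isColimitClopenSheaf Y) (isColimitClopenSheaf X)

end Comparison

section Algebra

open TensorProduct

/-! ### Étale algebras over integrally closed domains -/

/-- Every prime of an étale algebra `B` over an integrally closed domain `A` has a neighbourhood
`D(b)` containing at most one prime over the zero ideal of `A`. The generic fibre of `B` is a finite
discrete space, and the idempotents cutting out its points are integral over `B`, hence lie in `B`
because integral closure commutes with étale base change. -/
lemma exists_notMem_forall_eq_of_comap_eq_bot (A B : Type u) [CommRing A] [IsDomain A]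
    [IsIntegrallyClosed A] [CommRing B] [Algebra A B] [Algebra.Etale A B] (q : PrimeSpectrum B) :
    ∃ b : B, b ∉ q.asIdeal ∧ ∀ x x' : PrimeSpectrum B, b ∉ x.asIdeal → b ∉ x'.asIdeal →
      x.asIdeal.comap (algebraMap A B) = ⊥ → x'.asIdeal.comap (algebraMap A B) = ⊥ → x = x' := by
  let K := FractionRing A
  let C := B ⊗[A] K
  let M := Algebra.algebraMapSubmonoid B (nonZeroDivisors A)
  have hloc : IsLocalization M C := inferInstance
  have : Algebra.Etale K (K ⊗[A] B) := inferInstance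
  have : Module.Finite K (K ⊗[A] B) := Algebra.FormallyUnramified.finite_of_free K _
  have : IsArtinianRing (K ⊗[A] B) := IsArtinianRing.of_finite K _
  have hart : IsArtinianRing C :=
    (Algebra.TensorProduct.comm A B K).toRingEquiv.symm.surjective.isArtinianRing
  have hinj : Function.Injective (algebraMap B C) := by
    have := Module.Flat.lTensor_preserves_injective_linearMap (M := B)
      (Algebra.linearMap A K) (IsFractionRing.injective A K)
    intro b b' h
    have h' := @this (b ⊗ₜ 1) (b' ⊗ₜ 1) (by
      simp only [LinearMap.lTensor_tmul, Algebra.linearMap_apply, map_one]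
      exact h)
    simpa using congr_arg (TensorProduct.rid A B) h'
  -- Idempotents of the generic fibre are integral over `B`, hence come from `B`.
  have hlift (e : C) (he : IsIdempotentElem e) : ∃ b : B, algebraMap B C b = e := by
    have hint : IsIntegral B e := by
      refine ⟨Polynomial.X ^ 2 - Polynomial.X, ?_, ?_⟩
      · monicity!
      · simp [sq, he.eq]
    obtain ⟨t, ht⟩ := (TensorProduct.toIntegralClosure_bijective_of_smooth (R := A) (S := B)
      (B := K)).2 ⟨e, hint⟩
    obtain rfl : (TensorProduct.toIntegralClosure A B K t : C) = e := congr_arg Subtype.val ht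
    clear ht hint he
    induction t with
    | zero => exact ⟨0, by simp⟩
    | add x y hx hy =>
      obtain ⟨b, hb⟩ := hx
      obtain ⟨b', hb'⟩ := hy
      exact ⟨b + b', by simp [hb, hb']⟩
    | tmul b x =>
      obtain ⟨a, ha⟩ := (IsIntegrallyClosed.isIntegral_iff (K := K)).1 x.2
      refine ⟨a • b, ?_⟩
      change _ = b ⊗ₜ[A] (x : K)
      change (a • b) ⊗ₜ[A] (1 : K) = _
      rw [← ha, Algebra.algebraMap_eq_smul_one, TensorProduct.smul_tmul]
  -- Each point of the finite discrete generic fibre is cut out by an idempotent of `B`.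
  have hpt (x : PrimeSpectrum C) : ∃ b : B, IsIdempotentElem b ∧
      ∀ y : PrimeSpectrum C, algebraMap B C b ∉ y.asIdeal ↔ y = x := by
    obtain ⟨e, he, hxe⟩ := PrimeSpectrum.isClopen_iff.1 (isClopen_discrete {x})
    obtain ⟨b, rfl⟩ := hlift e he
    exact ⟨b, hinj (by simpa using he.eq), fun y ↦ (Set.ext_iff.1 hxe y).symm⟩
  choose b hb' hb using hpt
  have := Fintype.ofFinite (PrimeSpectrum C)
  -- Hence every prime of `B` lies in the locus `D(b x)` for one of the points `x`.
  have hnil : IsNilpotent (∏ x, (1 - b x)) := by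
    rw [← IsNilpotent.map_iff hinj, nilpotent_iff_mem_prime]
    intro J hJ
    rw [map_prod]
    refine Ideal.mem_of_dvd _ (Finset.dvd_prod_of_mem _ (Finset.mem_univ ⟨J, hJ⟩)) ?_
    have hne : algebraMap B C (b ⟨J, hJ⟩) ∉ J := (hb ⟨J, hJ⟩ ⟨J, hJ⟩).2 rfl
    have hmul : algebraMap B C (b ⟨J, hJ⟩) * algebraMap B C (1 - b ⟨J, hJ⟩) = 0 := by
      rw [← map_mul, mul_sub, mul_one, (hb' _).eq, sub_self, map_zero]
    exact (hJ.mem_or_mem (hmul ▸ J.zero_mem)).resolve_left hne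
  obtain ⟨x₀, -, hx₀⟩ := Ideal.IsPrime.prod_mem_iff.1 (nilpotent_iff_mem_prime.1 hnil _ q.2)
  have hrange (x : PrimeSpectrum B) (hx : x.asIdeal.comap (algebraMap A B) = ⊥) :
      ∃ y : PrimeSpectrum C, y.comap (algebraMap B C) = x := by
    change x ∈ Set.range (PrimeSpectrum.comap (algebraMap B C))
    rw [PrimeSpectrum.localization_comap_range C M, Set.mem_ofPred_eq, Set.disjoint_left]
    rintro _ ⟨a, ha, rfl⟩ hax
    have : a ∈ x.asIdeal.comap (algebraMap A B) := hax
    rw [hx, Ideal.mem_bot] at this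
    exact nonZeroDivisors.ne_zero ha this
  refine ⟨b x₀, fun h ↦ q.2.ne_top ((Ideal.eq_top_iff_one _).2 ?_), ?_⟩
  · simpa using Ideal.add_mem _ hx₀ h
  · intro x x' hx hx' hx0 hx0'
    obtain ⟨y, rfl⟩ := hrange x hx0
    obtain ⟨y', rfl⟩ := hrange x' hx0'
    rw [(hb x₀ y).1 hx, (hb x₀ y').1 hx']

/-! ### Idempotents of tensor products over a separably closed subfield -/

/-- Derivations kill idempotents. Hence if `∑ bᵢ ⊗ xᵢ` is idempotent, for a basis `b` of `L`, then
the universal derivation kills all `xᵢ`. -/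
lemma kaehlerDifferentialD_eq_zero_of_isIdempotentElem {K F L ι : Type*} [Field K] [CommRing F]
    [Algebra K F] [CommRing L] [Algebra K L] (b : Module.Basis ι K L) (x : ι →₀ F)
    (he : IsIdempotentElem (x.sum fun i y ↦ b i ⊗ₜ[K] y)) (i : ι) :
    KaehlerDifferential.D K F (x i) = 0 := by
  generalize hx : x.sum (fun i y ↦ b i ⊗ₜ[K] y) = e at he
  let := Algebra.TensorProduct.rightAlgebra (R := K) (A := L) (B := F)
  have hD : KaehlerDifferential.D L (L ⊗[K] F) e = 0 := by
    have h₁ := congr_arg (KaehlerDifferential.D L (L ⊗[K] F)) he.eq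
    rw [Derivation.leibniz] at h₁
    have h₂ := congr_arg (e • ·) h₁
    simp only [smul_add, smul_smul, he.eq, add_eq_left] at h₂
    rw [← h₁, h₂, add_zero]
  have h₁ : (x.mapRange (KaehlerDifferential.D K F) (map_zero _)).sum
      (fun i y ↦ b i ⊗ₜ[K] y) = 0 := by
    apply (KaehlerDifferential.tensorKaehlerEquivBase K L F (L ⊗[K] F)).injective
    rw [map_zero, ← hD, ← hx, Finsupp.sum_mapRange_index (by simp), Finsupp.sum, Finsupp.sum,
      map_sum, map_sum]
    refine Finset.sum_congr rfl fun i _ ↦ ?_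
    rw [KaehlerDifferential.tensorKaehlerEquivBase_tmul, KaehlerDifferential.map_D,
      ← Derivation.map_smul]
    rw [Algebra.TensorProduct.right_algebraMap_apply, TensorProduct.smul_tmul', smul_eq_mul,
      mul_one]
  simpa using DFunLike.congr_fun (TensorProduct.sum_tmul_basis_left_eq_zero b _ h₁) i

/-- A field extension generated by finitely many elements killed by the universal derivation is
unramified, hence separable. -/
lemma isSeparable_of_kaehlerDifferentialD_eq_zero {K F : Type*} [Field K] [Field F]
    [Algebra K F] {S : Set F} (hS : S.Finite) (hS' : IntermediateField.adjoin K S = ⊤)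
    (hD : ∀ s ∈ S, KaehlerDifferential.D K F s = 0) : Algebra.IsSeparable K F := by
  have hDF (y : F) : KaehlerDifferential.D K F y = 0 := by
    have hy : y ∈ IntermediateField.adjoin K S := hS' ▸ IntermediateField.mem_top
    induction hy using IntermediateField.adjoin_induction with
    | mem y hy => exact hD y hy
    | algebraMap y => exact Derivation.map_algebraMap _ y
    | add y z _ _ h h' => rw [map_add, h, h', add_zero]
    | inv y _ h => rw [Derivation.leibniz_inv, h, smul_zero]
    | mul y z _ _ h h' => rw [Derivation.leibniz, h, h', smul_zero, smul_zero, add_zero]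
  have : Algebra.FormallyUnramified K F := by
    refine ⟨subsingleton_of_forall_eq 0 fun ω ↦ ?_⟩
    have hω : ω ∈ Submodule.span F (Set.range (KaehlerDifferential.D K F)) := by
      rw [KaehlerDifferential.span_range_derivation]
      trivial
    induction hω using Submodule.span_induction with
    | mem ω hω =>
      obtain ⟨y, rfl⟩ := hω
      exact hDF y
    | zero => rfl
    | add _ _ _ _ h h' => rw [h, h', add_zero]
    | smul _ _ _ h => rw [h, smul_zero]
  have : Algebra.EssFiniteType K F :=
    IntermediateField.fg_top_iff.1 (IntermediateField.fg_def.2 ⟨_, hS, hS'⟩)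
  exact (Algebra.FormallyUnramified.iff_isSeparable K F).1 ‹_›

/-- If `K` is separably closed in `E`, then `L ⊗[K] E` has only trivial idempotents. -/
lemma eq_zero_or_one_of_isIdempotentElem_tensorProduct {K E L : Type*} [Field K] [Field E]
    [Algebra K E] [CommRing L] [IsDomain L] [Algebra K L] (h : separableClosure K E = ⊥)
    {e : L ⊗[K] E} (he : IsIdempotentElem e) : e = 0 ∨ e = 1 := by
  let b := Module.Basis.ofVectorSpace K L
  obtain ⟨x, rfl⟩ := TensorProduct.eq_repr_basis_left b e
  have hfin : (Set.range x).Finite := x.finite_range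
  have hxF (i) : x i ∈ IntermediateField.adjoin K (Set.range x) :=
    IntermediateField.subset_adjoin _ _ ⟨i, rfl⟩
  -- The coefficients `x i` are separable over `K`: they generate an unramified extension.
  have hsep : Algebra.IsSeparable K (IntermediateField.adjoin K (Set.range x)) := by
    refine isSeparable_of_kaehlerDifferentialD_eq_zero
      (hfin.preimage Subtype.val_injective.injOn)
      (IntermediateField.map_injective (IntermediateField.val _) ?_) ?_
    · rw [IntermediateField.adjoin_map, ← AlgHom.fieldRange_eq_map, IntermediateField.fieldRange_val,
        IntermediateField.coe_val, Set.image_preimage_eq_of_subset]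
      rintro _ ⟨i, rfl⟩
      exact ⟨⟨x i, hxF i⟩, rfl⟩
    rintro ⟨_, _⟩ ⟨i, rfl⟩
    let x' : _ →₀ IntermediateField.adjoin K (Set.range x) :=
      Finsupp.onFinset x.support (fun i ↦ ⟨x i, hxF i⟩) fun i hi ↦
        Finsupp.mem_support_iff.2 fun h0 ↦ hi (Subtype.ext h0)
    refine kaehlerDifferentialD_eq_zero_of_isIdempotentElem b x' ?_ i
    have hφ : Function.Injective (Algebra.TensorProduct.map (AlgHom.id K L)
        (IntermediateField.adjoin K (Set.range x)).val) :=
      Module.Flat.lTensor_preserves_injective_linearMap (M := L)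
        (IntermediateField.adjoin K (Set.range x)).val.toLinearMap
        (IntermediateField.adjoin K (Set.range x)).val.toRingHom.injective
    have hx' : Algebra.TensorProduct.map (AlgHom.id K L)
        (IntermediateField.adjoin K (Set.range x)).val (x'.sum fun i y ↦ b i ⊗ₜ[K] y) =
          x.sum fun i y ↦ b i ⊗ₜ[K] y := by
      rw [Finsupp.onFinset_sum _ (by simp), map_sum]
      rfl
    exact hφ (by rw [map_mul, hx', he.eq])
  have hxK (i) : ∃ a : K, algebraMap K E a = x i := by
    have hi := (le_separableClosure_iff K E _).2 hsep (hxF i)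
    rwa [h, IntermediateField.mem_bot] at hi
  choose a ha using hxK
  obtain ⟨l, hl⟩ : ∃ l : L, l ⊗ₜ 1 = x.sum fun i y ↦ b i ⊗ₜ[K] y := by
    refine ⟨∑ i ∈ x.support, a i • b i, ?_⟩
    rw [TensorProduct.sum_tmul, Finsupp.sum]
    refine Finset.sum_congr rfl fun i _ ↦ ?_
    rw [TensorProduct.smul_tmul, ← Algebra.algebraMap_eq_smul_one, ha]
  rw [← hl] at he ⊢
  have hinj : Function.Injective (algebraMap L (L ⊗[K] E)) :=
    FaithfulSMul.algebraMap_injective _ _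
  have hl' : IsIdempotentElem l := hinj (by rw [map_mul]; exact he)
  rcases IsIdempotentElem.iff_eq_zero_or_one.1 hl' with rfl | rfl
  · exact .inl (TensorProduct.zero_tmul _ _)
  · exact .inr rfl

/-! ### Étale algebras attached to separable elements -/

/-- For every element `α` of an extension `E` of the fraction field `K` of `A` that is separable
over `K`, there is an étale `A`-algebra `B ⊆ E` that is a domain and witnesses whether `α ∈ K`:
if `B` has a single `A`-algebra map to an algebraic closure of `E`, then `α` lies in `K`. Up to
scaling `α` by an element of `A`, the algebra `B` is `A[α]` with `f'(α)` inverted, where `f` is the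
minimal polynomial. -/
lemma exists_etale_of_isSeparable {A K E : Type u} [CommRing A] [IsDomain A] [IsIntegrallyClosed A]
    [Field K] [Algebra A K] [IsFractionRing A K] [Field E] [Algebra A E] [Algebra K E]
    [IsScalarTower A K E] {α : E} (hα : IsSeparable K α) :
    ∃ (B : Type u) (_ : CommRing B) (_ : Algebra A B) (_ : Algebra.Etale A B) (_ : IsDomain B)
      (φ : B →ₐ[A] E),
      (∀ ψ : B →ₐ[A] AlgebraicClosure E, ∀ b, ψ b = algebraMap E _ (φ b)) →
        ∃ k : K, algebraMap K E k = α := by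
  have halg : IsAlgebraic A α := (IsFractionRing.isAlgebraic_iff A K E).2 hα.isIntegral.isAlgebraic
  obtain ⟨a, ha0, ha⟩ := halg.exists_integral_multiple
  have haK : algebraMap A K a ≠ 0 := by simpa using ha0
  set α' := a • α with hα'
  have hα'' : α' = algebraMap A K a • α := by rw [hα', algebraMap_smul]
  have hsep : (minpoly K α').Separable := by
    rw [hα'', Algebra.smul_def]
    exact Field.isSeparable_mul (isSeparable_algebraMap (F := K) _) hα
  have : FaithfulSMul A E := by
    rw [faithfulSMul_iff_algebraMap_injective, IsScalarTower.algebraMap_eq A K E]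
    exact (algebraMap K E).injective.comp (IsFractionRing.injective A K)
  have : Module.IsTorsionFree A E := inferInstance
  let f := minpoly A α'
  have hf : minpoly K α' = f.map (algebraMap A K) :=
    minpoly.isIntegrallyClosed_eq_field_fractions K E ha
  -- The unit inverted is the derivative of `f` itself, which is nonzero at the roots of `f`.
  let P : StandardEtalePair A := ⟨f, minpoly.monic ha, f.derivative, 1, 0, 1, by simp⟩
  have hP {Ω : Type u} [Field Ω] [Algebra A Ω] [Algebra K Ω] [IsScalarTower A K Ω] (β : Ω)
      (hβ : Polynomial.aeval β (minpoly K α') = 0) : P.HasMap β := by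
    refine ⟨by simpa [hf] using hβ, ?_⟩
    have := hsep.aeval_derivative_ne_zero hβ
    rw [hf, Polynomial.derivative_map, Polynomial.aeval_map_algebraMap] at this
    exact this.isUnit
  have hmap : P.HasMap α' := hP α' (minpoly.aeval _ _)
  have hdom : IsDomain (AdjoinRoot f) :=
    AdjoinRoot.isDomain_of_prime (minpoly.prime_of_isIntegrallyClosed ha)
  have hdom' : IsDomain (Localization.Away (AdjoinRoot.mk f f.derivative)) := by
    refine IsLocalization.isDomain_localization (powers_le_nonZeroDivisors_of_noZeroDivisors ?_)
    intro h0
    obtain ⟨g, hg⟩ := AdjoinRoot.mk_eq_zero.1 h0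
    refine hmap.2.ne_zero ?_
    change Polynomial.aeval α' f.derivative = 0
    rw [hg, map_mul, minpoly.aeval, zero_mul]
  have : IsDomain P.Ring := P.equivAwayAdjoinRoot.toRingEquiv.toMulEquiv.isDomain _
  refine ⟨P.Ring, inferInstance, inferInstance, inferInstance, this, P.lift α' hmap, fun H ↦ ?_⟩
  have hroot (β : AlgebraicClosure E) (hβ : Polynomial.aeval β (minpoly K α') = 0) :
      β = algebraMap E _ α' := by
    simpa using H (P.lift β (hP β hβ)) P.X
  -- The minimal polynomial is separable with a single root.
  have hdeg : (minpoly K α').natDegree = 1 := by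
    refine le_antisymm ?_ (minpoly.natDegree_pos (isAlgebraic_iff_isIntegral.1 ?_))
    · rw [← Polynomial.card_rootSet_eq_natDegree (K := AlgebraicClosure E) hsep
        (IsAlgClosed.splits _), Fintype.card_le_one_iff]
      intro x y
      ext
      rw [hroot x (Polynomial.aeval_eq_zero_of_mem_rootSet x.2),
        hroot y (Polynomial.aeval_eq_zero_of_mem_rootSet y.2)]
    · exact (hα'' ▸ hα.isIntegral.isAlgebraic.smul _)
  obtain ⟨k, hk⟩ := minpoly.natDegree_eq_one_iff.1 hdeg
  refine ⟨(algebraMap A K a)⁻¹ * k, ?_⟩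
  rw [map_mul, hk, hα'', ← Algebra.smul_def, inv_smul_smul₀ haK]

end Algebra

/-! ### Maps with locally preconnected fibres over a dense image -/

section Topology

/-- Descent of functions along a map that meets every nonempty open subset: a function that is
constant on the preimages of the members of an open cover descends to a locally constant
function. -/
lemma exists_isLocallyConstant_comp_eq {T V Z : Type*} [TopologicalSpace V] {p : T → V} {d : T → Z}
    (hd : ∀ W : Set V, IsOpen W → W.Nonempty → (p ⁻¹' W).Nonempty)
    (hc : ∀ v, ∃ W : Set V, IsOpen W ∧ v ∈ W ∧ ∀ s ∈ p ⁻¹' W, ∀ t ∈ p ⁻¹' W, d s = d t) :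
    ∃ F : V → Z, IsLocallyConstant F ∧ ∀ t, F (p t) = d t := by
  choose W hW hvW hcW using hc
  choose t ht using fun v ↦ hd (W v) (hW v) ⟨v, hvW v⟩
  refine ⟨fun v ↦ d (t v), ?_, fun s ↦ hcW _ _ (ht _) _ (hvW (p s))⟩
  refine (IsLocallyConstant.iff_exists_open _).2 fun v ↦ ⟨W v, hW v, hvW v, fun v' hv' ↦ ?_⟩
  obtain ⟨s, hs, hs'⟩ := hd _ ((hW v).inter (hW v')) ⟨v', hv', hvW v'⟩
  exact (hcW v' _ (ht v') _ hs').trans (hcW v _ hs _ (ht v))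

variable {T V : Type*} [TopologicalSpace T] [TopologicalSpace V] {p : T → V} (hp : Continuous p)
  (hd : ∀ W : Set V, IsOpen W → W.Nonempty → (p ⁻¹' W).Nonempty)
  (hc : ∀ v, ∃ W : Set V, IsOpen W ∧ v ∈ W ∧ IsPreconnected (p ⁻¹' W))

include hp hd hc

/-- If `p` meets all nonempty open subsets and has locally preconnected preimages, then clopen subsets
descend uniquely along `p`. -/
lemma bijective_comp_of_isPreconnected_preimage :
    Function.Bijective fun c : C(V, Bool) ↦ c.comp ⟨p, hp⟩ := by
  constructor
  · intro c c' h
    by_contra hne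
    obtain ⟨v, hv⟩ : ∃ v, c v ≠ c' v := by
      by_contra! H
      exact hne (ContinuousMap.ext H)
    have hopen : IsOpen {v | c v ≠ c' v} :=
      (isOpen_discrete {b : Bool × Bool | b.1 ≠ b.2}).preimage (c.continuous.prodMk c'.continuous)
    obtain ⟨t, ht⟩ := hd _ hopen ⟨v, hv⟩
    exact ht (DFunLike.congr_fun h t)
  · intro d
    obtain ⟨F, hF, hFd⟩ := exists_isLocallyConstant_comp_eq (d := d) hd fun v ↦ by
      obtain ⟨W, hW, hv, hWp⟩ := hc v
      exact ⟨W, hW, hv, fun s hs t ht ↦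
        ((IsLocallyConstant.iff_continuous d).2 d.continuous).apply_eq_of_isPreconnected hWp hs ht⟩
    exact ⟨⟨F, hF.continuous⟩, ContinuousMap.ext hFd⟩

lemma bijective_connectedComponentsMap_of_isPreconnected_preimage :
    Function.Bijective hp.connectedComponentsMap := by
  constructor
  · intro a b
    obtain ⟨s, rfl⟩ := ConnectedComponents.surjective_coe a
    obtain ⟨t, rfl⟩ := ConnectedComponents.surjective_coe b
    intro h
    obtain ⟨F, hF, hFd⟩ := exists_isLocallyConstant_comp_eq (d := (ConnectedComponents.mk : T → _))
      hd fun v ↦ by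
        obtain ⟨W, hW, hv, hWp⟩ := hc v
        exact ⟨W, hW, hv, fun s hs t ht ↦ ConnectedComponents.coe_eq_coe.2
          ((connectedComponent_eq (hWp.subset_connectedComponent hs ht)))⟩
    have h' : connectedComponent (p s) = connectedComponent (p t) :=
      ConnectedComponents.coe_eq_coe.1 h
    rw [← hFd, ← hFd]
    exact hF.apply_eq_of_isPreconnected isPreconnected_connectedComponent
      mem_connectedComponent (h' ▸ mem_connectedComponent)
  · intro a
    obtain ⟨v, rfl⟩ := ConnectedComponents.surjective_coe a
    obtain ⟨W, hW, hv, hWp⟩ := hc v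
    obtain ⟨t, ht⟩ := hd W hW ⟨v, hv⟩
    have hWc : IsPreconnected W := by
      refine (hWp.image p hp.continuousOn).subset_closure (Set.image_preimage_subset p W) ?_
      intro w hw
      refine mem_closure_iff.2 fun O hO hwO ↦ ?_
      obtain ⟨s, hs, hs'⟩ := hd _ (hO.inter hW) ⟨w, hwO, hw⟩
      exact ⟨p s, hs, s, hs', rfl⟩
    exact ⟨ConnectedComponents.mk t, ConnectedComponents.coe_eq_coe.2
      (connectedComponent_eq (hWc.subset_connectedComponent ht hv))⟩

end Topology

/-! ### Étale schemes over normal integral schemes -/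

section Normal

/-- Being integrally closed is checked at the maximal ideals, whose localizations are stalks. -/
lemma isIntegrallyClosed_of_isAffineOpen {X : Scheme.{u}} [AlgebraicGeometry.IsIntegral X]
    [IsNormalScheme X] {U : X.Opens} (hU : IsAffineOpen U) [Nonempty U] :
    IsIntegrallyClosed Γ(X, U) := by
  refine IsIntegrallyClosed.of_localization_maximal fun P _ hP ↦ ?_
  let y : PrimeSpectrum Γ(X, U) := ⟨P, hP.isPrime⟩
  have hy : hU.fromSpec y ∈ U := by
    have : hU.fromSpec y ∈ Set.range hU.fromSpec := ⟨y, rfl⟩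
    rwa [hU.range_fromSpec] at this
  let _ : Algebra Γ(X, U) (X.presheaf.stalk (hU.fromSpec y)) :=
    (X.presheaf.germ U (hU.fromSpec y) hy).hom.toAlgebra
  have : IsLocalization.AtPrime (X.presheaf.stalk (hU.fromSpec y)) y.asIdeal :=
    hU.isLocalization_stalk' y hy
  have := IsNormalScheme.isIntegrallyClosed_stalk (hU.fromSpec y)
  exact IsIntegrallyClosed.of_equiv
    (IsLocalization.algEquiv P.primeCompl (X.presheaf.stalk (hU.fromSpec y))
      (Localization.AtPrime P)).toRingEquiv

/-- A scheme étale over a normal integral scheme `Y` is covered by open subsets that contain at most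
one point over the generic point of `Y`. -/
lemma exists_open_forall_eq_of_etale {T Y : Scheme.{u}} [AlgebraicGeometry.IsIntegral Y]
    [IsNormalScheme Y] (g : T ⟶ Y) [Etale g] (t : T) :
    ∃ W : Set T, IsOpen W ∧ t ∈ W ∧ ∀ x ∈ W, ∀ x' ∈ W, g x = genericPoint Y →
      g x' = genericPoint Y → x = x' := by
  obtain ⟨_, ⟨U, hU, rfl⟩, htU, -⟩ :=
    Y.isBasis_affineOpens.exists_subset_of_mem_open (Set.mem_univ (g t)) isOpen_univ
  obtain ⟨_, ⟨V, hV, rfl⟩, htV, hVU⟩ :=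
    T.isBasis_affineOpens.exists_subset_of_mem_open (show t ∈ (g ⁻¹ᵁ U : Set T) from htU)
      (g ⁻¹ᵁ U).isOpen
  have : Nonempty U := ⟨⟨_, htU⟩⟩
  have := isIntegrallyClosed_of_isAffineOpen hU
  have hU : IsAffineOpen U := hU
  have hoi : IsOpenImmersion hU.fromSpec := inferInstance
  have hle : V ≤ g ⁻¹ᵁ U := hVU
  let _ : Algebra Γ(Y, U) Γ(T, V) := (g.appLE U V hle).hom.toAlgebra
  have het : (g.appLE U V hle).hom.Etale := g.etale_appLE hU hV hle
  have : Algebra.Etale Γ(Y, U) Γ(T, V) := het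
  have hrange : ∀ {x : T}, x ∈ V → ∃ q, hV.fromSpec q = x := fun {x} hx ↦ by
    have : x ∈ Set.range hV.fromSpec := by rw [hV.range_fromSpec]; exact hx
    exact this
  obtain ⟨q, hq⟩ := hrange htV
  obtain ⟨b, hb, H⟩ := exists_notMem_forall_eq_of_comap_eq_bot Γ(Y, U) Γ(T, V) q
  have key : ∀ r : Spec Γ(T, V), g (hV.fromSpec r) = genericPoint Y →
      r.asIdeal.comap (algebraMap Γ(Y, U) Γ(T, V)) = ⊥ := fun r hr ↦ by
    have h₁ : hU.fromSpec (Spec.map (g.appLE U V hle) r) = genericPoint Y := by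
      rw [← hr, ← Scheme.Hom.comp_apply, hU.SpecMap_appLE_fromSpec g hV hle,
        Scheme.Hom.comp_apply]
    have h₂ : Spec.map (g.appLE U V hle) r = genericPoint (Spec Γ(Y, U)) :=
      hU.fromSpec.isOpenEmbedding.injective
        (h₁.trans (genericPoint_eq_of_isOpenImmersion hU.fromSpec).symm)
    exact congr_arg PrimeSpectrum.asIdeal (h₂.trans (genericPoint_eq_bot_of_affine _))
  have hmem : ∀ r : Spec Γ(T, V), hV.fromSpec r ∈ T.basicOpen b ↔ b ∉ r.asIdeal := fun r ↦ by
    change r ∈ hV.fromSpec ⁻¹ᵁ T.basicOpen b ↔ _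
    rw [hV.fromSpec_preimage_basicOpen]
    rfl
  refine ⟨T.basicOpen b, (T.basicOpen b).isOpen, ?_, ?_⟩
  · rw [← hq]
    exact (hmem q).2 hb
  · intro x hx x' hx' hg hg'
    obtain ⟨r, rfl⟩ := hrange (T.basicOpen_le b hx)
    obtain ⟨r', rfl⟩ := hrange (T.basicOpen_le b hx')
    rw [H r r' ((hmem r).1 hx) ((hmem r').1 hx') (key r hg) (key r' hg')]

/-- Two points over the generic point of a preconnected scheme étale over a normal integral scheme
coincide: sending a small open subset to its unique point over the generic point defines a locally
constant function. -/
lemma eq_of_etale_of_preconnectedSpace {T Y : Scheme.{u}} [AlgebraicGeometry.IsIntegral Y]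
    [IsNormalScheme Y] (g : T ⟶ Y) [Etale g] [PreconnectedSpace T] {x x' : T}
    (hx : g x = genericPoint Y) (hx' : g x' = genericPoint Y) : x = x' := by
  let Z := {t : T // g t = genericPoint Y}
  obtain ⟨F, hF, hFd⟩ := exists_isLocallyConstant_comp_eq (p := (Subtype.val : Z → T)) (d := id)
    (fun W hW hne ↦ by
      obtain ⟨_, ⟨t, ht, rfl⟩⟩ := hne.image g
      obtain ⟨s, hs, hs'⟩ := ((genericPoint_spec Y).mem_open_set_iff
        (g.isOpenMap W hW)).2 ⟨_, trivial, t, ht, rfl⟩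
      exact ⟨⟨s, hs'⟩, hs⟩)
    (fun t ↦ by
      obtain ⟨W, hW, ht, H⟩ := exists_open_forall_eq_of_etale g t
      exact ⟨W, hW, ht, fun s hs s' hs' ↦ Subtype.ext (H _ hs _ hs' s.2 s'.2)⟩)
  have h := hF.apply_eq_of_preconnectedSpace x x'
  exact congr_arg Subtype.val (((hFd ⟨x, hx⟩).symm.trans h).trans (hFd ⟨x', hx'⟩))

end Normal

section GenericFibre

variable {X Y V : Scheme.{u}} (f : Y ⟶ X) (g : V ⟶ X)

/-- Étale morphisms are open, so the image of a nonempty open subset of `V` meets the dense image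
of `f`. -/
lemma nonempty_preimage_pullback_fst [Etale g] [IsDominant f] (W : Set V) (hW : IsOpen W)
    (hne : W.Nonempty) : ((pullback.fst g f) ⁻¹' W).Nonempty := by
  obtain ⟨_, ⟨v, hv, rfl⟩, y, hy⟩ := f.denseRange.inter_open_nonempty (g '' W)
    (g.isOpenMap W hW) (hne.image g)
  obtain ⟨t, ht, -⟩ := Scheme.Pullback.exists_preimage_pullback v y hy.symm
  exact ⟨t, by rwa [Set.mem_preimage, ht]⟩

/-- The fibre of `V ×[X] Y` over a point of `V` above the generic point of `X` is a base change of the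
generic fibre of `f` to an extension field. -/
lemma isPreconnected_preimage_pullback_fst_singleton [IrreducibleSpace X]
    (hf : GeometricallyConnectedGenericFibre f) {v : V} (hv : g v = genericPoint X) :
    _root_.IsPreconnected (pullback.fst g f ⁻¹' {v}) := by
  have hf' : GeometricallyConnected (f.fiberToSpecResidueField (g v)) := by rw [hv]; exact hf
  let p := pullback.fst g f
  have sq : IsPullback (p.fiberι v ≫ pullback.snd g f) (p.fiberToSpecResidueField v) f
      (Spec.map (g.residueFieldMap v) ≫ X.fromSpecResidueField (g v)) := by
    rw [Scheme.Hom.SpecMap_residueFieldMap_fromSpecResidueField]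
    exact (IsPullback.of_hasPullback p (V.fromSpecResidueField v)).paste_horiz
      (IsPullback.of_hasPullback g f).flip |>.flip |>.flip
  have sq' : IsPullback (pullback.lift (p.fiberι v ≫ pullback.snd g f)
      (p.fiberToSpecResidueField v ≫ Spec.map (g.residueFieldMap v)) (by simpa using sq.w))
      (p.fiberToSpecResidueField v) (f.fiberToSpecResidueField (g v))
      (Spec.map (g.residueFieldMap v)) := by
    refine IsPullback.of_right ?_ (pullback.lift_snd _ _ _)
      (IsPullback.of_hasPullback f (X.fromSpecResidueField (g v)))
    rw [pullback.lift_fst]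
    exact sq
  have : ConnectedSpace (p.fiber v) :=
    hf'.geometrically_connectedSpace (K := V.residueField v) _ _ _ sq'
  rw [← p.range_fiberι v]
  exact isPreconnected_range (p.fiberι v).continuous

/-- For an open subset `W` of `V` with at most one point over the generic point of `X`, the fibre over
that point is preconnected and dense in the preimage of `W`. -/
lemma exists_open_isPreconnected_preimage_pullback_fst [AlgebraicGeometry.IsIntegral X]
    [AlgebraicGeometry.IsIntegral Y] [IsNormalScheme X] [IsDominant f] [Etale g]
    (hf : GeometricallyConnectedGenericFibre f) (v : V) :
    ∃ W : Set V, IsOpen W ∧ v ∈ W ∧ _root_.IsPreconnected (pullback.fst g f ⁻¹' W) := by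
  obtain ⟨W, hW, hv, H⟩ := exists_open_forall_eq_of_etale g v
  refine ⟨W, hW, hv, ?_⟩
  let p := pullback.fst g f
  let q := pullback.snd g f
  -- Every nonempty open subset of the preimage of `W` contains a point over the generic point of
  -- `Y`, since the projection to `Y` is open.
  have hgen : ∀ O : Set ↥(pullback g f), IsOpen O → (O ∩ p ⁻¹' W).Nonempty →
      ∃ z ∈ O ∩ p ⁻¹' W, g (p z) = genericPoint X := fun O hO hne ↦ by
    obtain ⟨t, ht⟩ := hne
    obtain ⟨z, hz, hz'⟩ := ((genericPoint_spec Y).mem_open_set_iff (q.isOpenMap _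
      (hO.inter (hW.preimage p.continuous)))).2 ⟨_, trivial, t, ht, rfl⟩
    refine ⟨z, hz, ?_⟩
    rw [← Scheme.Hom.comp_apply, pullback.condition, Scheme.Hom.comp_apply, hz',
      map_genericPoint]
  rcases (p ⁻¹' W).eq_empty_or_nonempty with he | hne
  · exact he ▸ isPreconnected_empty
  obtain ⟨z₀, ⟨-, hz₀⟩, hz₀'⟩ := hgen Set.univ isOpen_univ (by simpa using hne)
  refine (isPreconnected_preimage_pullback_fst_singleton f g hf hz₀').subset_closure
    (Set.preimage_mono (Set.singleton_subset_iff.2 hz₀)) fun t ht ↦ ?_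
  refine mem_closure_iff.2 fun O hO htO ↦ ?_
  obtain ⟨z, ⟨hz, hzW⟩, hz'⟩ := hgen O hO ⟨t, htO, ht⟩
  exact ⟨z, hz, H _ hzW _ hz₀ hz' hz₀'⟩

variable {f} [AlgebraicGeometry.IsIntegral X] [AlgebraicGeometry.IsIntegral Y] [IsNormalScheme X]
  [IsDominant f]

lemma GeometricallyConnectedGenericFibre.pullbackPreservesClopens
    (hf : GeometricallyConnectedGenericFibre f) : PullbackPreservesClopens f :=
  fun _ g _ ↦ bijective_comp_of_isPreconnected_preimage (pullback.fst g f).continuous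
    (nonempty_preimage_pullback_fst f g) (exists_open_isPreconnected_preimage_pullback_fst f g hf)

lemma GeometricallyConnectedGenericFibre.pullbackPreservesPiZero
    (hf : GeometricallyConnectedGenericFibre f) : PullbackPreservesPiZero f :=
  fun _ g hg ↦ have := hg.etale
    bijective_connectedComponentsMap_of_isPreconnected_preimage (pullback.fst g f).continuous
    (nonempty_preimage_pullback_fst f g) (exists_open_isPreconnected_preimage_pullback_fst f g hf)

end GenericFibre

/-! ### Geometric connectedness of the generic fibre -/

lemma connectedSpace_spec_of_isIdempotentElem {R : CommRingCat.{u}} [Nontrivial R]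
    (h : ∀ e : R, IsIdempotentElem e → e = 0 ∨ e = 1) : ConnectedSpace (Spec R) where
  toPreconnectedSpace := by
    refine preconnectedSpace_iff_clopen.2 fun s hs ↦ ?_
    obtain ⟨e, he, rfl⟩ :=
      PrimeSpectrum.isClopen_iff.1 (show IsClopen (X := PrimeSpectrum R) s from hs)
    rcases h e he with rfl | rfl
    · left
      exact congr_arg SetLike.coe (PrimeSpectrum.basicOpen_zero (R := R))
    · right
      exact congr_arg SetLike.coe (PrimeSpectrum.basicOpen_one (R := R))
  toNonempty := inferInstanceAs (Nonempty (PrimeSpectrum R))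

lemma connectedSpace_of_isPullback_spec_of_separableClosure_eq_bot {K E L : Type u} [Field K]
    [Field E] [Field L] [Algebra K E] [Algebra K L] (h : separableClosure K E = ⊥) {P : Scheme.{u}}
    {a : P ⟶ Spec (.of E)} {b : P ⟶ Spec (.of L)}
    (sq : IsPullback a b (Spec.map (CommRingCat.ofHom (algebraMap K E)))
      (Spec.map (CommRingCat.ofHom (algebraMap K L)))) : ConnectedSpace P := by
  let e := sq.isoIsPullback _ _
    (isPullback_SpecMap_of_isPushout _ _ _ _ (CommRingCat.isPushout_tensorProduct K L E)).flip
  have : Nontrivial (CommRingCat.of (TensorProduct K L E)) :=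
    inferInstanceAs (Nontrivial (TensorProduct K L E))
  have : ConnectedSpace (Spec (CommRingCat.of (TensorProduct K L E))) :=
    connectedSpace_spec_of_isIdempotentElem
      fun x hx ↦ eq_zero_or_one_of_isIdempotentElem_tensorProduct h hx
  exact e.hom.homeomorph.connectedSpace_iff.2 this

lemma isPullback_of_comp_of_mono {C : Type*} [Category* C] {P X Y Z W : C} {fst : P ⟶ X}
    {snd : P ⟶ Y} {f : X ⟶ Z} {g : Y ⟶ Z} (i : Z ⟶ W) [Mono i]
    (sq : IsPullback fst snd (f ≫ i) (g ≫ i)) : IsPullback fst snd f g where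
  w := by simpa only [← Category.assoc, cancel_mono] using sq.w
  isLimit' := ⟨PullbackCone.IsLimit.mk _ (fun s ↦ sq.lift s.fst s.snd (by
    rw [← Category.assoc, s.condition, Category.assoc])) (fun s ↦ sq.lift_fst _ _ _)
    (fun s ↦ sq.lift_snd _ _ _) (fun s m h₁ h₂ ↦ sq.hom_ext (by simpa using h₁)
      (by simpa using h₂))⟩

section

variable {X Y : Scheme.{u}} [AlgebraicGeometry.IsIntegral X] [AlgebraicGeometry.IsIntegral Y]
  (f : Y ⟶ X) [IsDominant f]

lemma specMap_functionFieldMap_fromSpecStalk :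
    Spec.map (functionFieldMap f) ≫ X.fromSpecStalk (genericPoint X) =
      Y.fromSpecStalk (genericPoint Y) ≫ f := by
  rw [functionFieldMap, Spec.map_comp, Category.assoc,
    Scheme.SpecMap_stalkSpecializes_fromSpecStalk, Scheme.SpecMap_stalkMap_fromSpecStalk]

variable {f}

/-- The base change of `Y` along a field extension `L` of the function field `K` of `X` is connected
if `K(Y)` is primary over `K`: its nonempty open subsets contain points over the generic point of
`Y`, and these points form the image of the spectrum of `L ⊗ K(Y)`, which has no nontrivial
idempotents. -/
lemma IsPrimaryOnFunctionFields.connectedSpace (hf : IsPrimaryOnFunctionFields f)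
    {L : Type u} [Field L] (φ : X.functionField ⟶ .of L) {Z : Scheme.{u}} {fst : Z ⟶ Y}
    {snd : Z ⟶ Spec (.of L)}
    (sq : IsPullback fst snd f (Spec.map φ ≫ X.fromSpecStalk (genericPoint X))) :
    ConnectedSpace Z := by
  let ι := X.fromSpecStalk (genericPoint X)
  let h := pullback.fst fst (Y.fromSpecStalk (genericPoint Y))
  have : ConnectedSpace ↥(pullback fst (Y.fromSpecStalk (genericPoint Y))) := by
    have h₁ := (IsPullback.of_hasPullback fst (Y.fromSpecStalk (genericPoint Y))).flip.paste_vert sq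
    rw [← specMap_functionFieldMap_fromSpecStalk] at h₁
    have h₂ := isPullback_of_comp_of_mono _ h₁
    let _ : Algebra X.functionField Y.functionField := (functionFieldMap f).hom.toAlgebra
    let _ : Algebra X.functionField L := φ.hom.toAlgebra
    exact connectedSpace_of_isPullback_spec_of_separableClosure_eq_bot hf h₂
  let c : Z ⟶ pullback f ι :=
    pullback.lift fst (snd ≫ Spec.map φ) (by simpa using sq.w)
  -- The projection to the generic fibre is a base change of a morphism to the spectrum of a field.
  have hopen : IsOpenMap c := by
    have hc : IsPullback c snd (pullback.snd f ι) (Spec.map φ) :=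
      IsPullback.of_right (by rw [pullback.lift_fst]; exact sq) (pullback.lift_snd _ _ _)
        (IsPullback.of_hasPullback f ι)
    have : IsIntegral (Spec X.functionField) := inferInstance
    have : Subsingleton (Spec X.functionField) :=
      inferInstanceAs (Subsingleton (PrimeSpectrum X.functionField))
    have : UniversallyOpen (Spec.map φ) := inferInstance
    have : UniversallyOpen c := MorphismProperty.of_isPullback hc.flip this
    exact c.isOpenMap
  have hdense : DenseRange h := by
    refine dense_iff_inter_open.2 fun O hO hne ↦ ?_
    obtain ⟨O', hO', hcO⟩ := (pullback.fst f ι).isEmbedding.isInducing.isOpen_iff.1 (hopen O hO)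
    obtain ⟨z, hz⟩ := hne
    have hξ : genericPoint Y ∈ O' := ((genericPoint_spec Y).mem_open_set_iff hO').2
      ⟨_, trivial, (hcO.symm ▸ Set.mem_image_of_mem c hz : c z ∈ _)⟩
    obtain ⟨x, hx, -⟩ := Scheme.Pullback.exists_preimage_pullback (f := f) (g := ι) (genericPoint Y)
      (IsLocalRing.closedPoint _) (by
        rw [map_genericPoint]
        exact Scheme.fromSpecStalk_closedPoint.symm)
    have hxO : x ∈ c '' O := by
      rw [← hcO, Set.mem_preimage, hx]
      exact hξ
    obtain ⟨o, ho, rfl⟩ := hxO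
    rw [← Scheme.Hom.comp_apply, pullback.lift_fst] at hx
    obtain ⟨t, ht, -⟩ := Scheme.Pullback.exists_preimage_pullback (f := fst)
      (g := Y.fromSpecStalk (genericPoint Y)) o (IsLocalRing.closedPoint _)
      (hx.trans Scheme.fromSpecStalk_closedPoint.symm)
    exact ⟨o, ho, t, ht⟩
  have := hdense.preconnectedSpace h.continuous
  exact ⟨(inferInstance : Nonempty ↥(pullback fst (Y.fromSpecStalk (genericPoint Y)))).map h⟩

lemma IsPrimaryOnFunctionFields.geometricallyConnectedGenericFibre
    (hf : IsPrimaryOnFunctionFields f) : GeometricallyConnectedGenericFibre f where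
  geometrically_connectedSpace L _ y Z fst snd sq := by
    obtain ⟨ψ, rfl⟩ := Spec.map_surjective y
    refine hf.connectedSpace (X.residue (genericPoint X) ≫ ψ)
      (fst := fst ≫ f.fiberι (genericPoint X)) (snd := snd) ?_
    rw [Spec.map_comp, Category.assoc]
    exact sq.paste_horiz (IsPullback.of_hasPullback f (X.fromSpecResidueField (genericPoint X)))

end

/-! ### The extension of function fields -/

/-- An étale scheme with one point over a field `E` and a section over `E` is the spectrum
of `E`. -/
lemma isIso_of_etale_of_subsingleton_of_section {P S : Scheme.{u}} (π : P ⟶ S) [Etale π]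
    [Subsingleton P] (σ : S ⟶ P) [Nonempty S] (h : σ ≫ π = 𝟙 S) : IsIso π := by
  have : Etale (σ ≫ π) := by rw [h]; infer_instance
  have : Etale σ := Etale.of_comp σ π
  have : Mono σ := mono_of_mono_fac h
  have : IsOpenImmersion σ := IsOpenImmersion.of_flat_of_mono σ
  have : Surjective σ := ⟨fun x ↦ ⟨Classical.arbitrary S, Subsingleton.elim _ _⟩⟩
  have : IsIso σ := (isIso_iff_isOpenImmersion_and_surjective σ).2 ⟨inferInstance, inferInstance⟩
  rw [← IsIso.inv_eq_of_hom_inv_id h]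
  infer_instance

section

variable {X Y : Scheme.{u}} [AlgebraicGeometry.IsIntegral X] [AlgebraicGeometry.IsIntegral Y]
  [IsNormalScheme X] [IsNormalScheme Y] {f : Y ⟶ X}

/-- If the base changes to `Y` of irreducible affine étale `X`-schemes `V` are connected, then a
separable element `α` of a field `E` over the generic point of `Y` lies in the function field of
`X`. For `V` as constructed from `α`, the base change to `Y` has a single point over the generic
point of `Y`, and so all the conjugates of `α` agree. -/
lemma exists_algebraMap_eq_of_isSeparable_of_forall_preconnectedSpace
    (H : ∀ (V : Scheme.{u}) (g : V ⟶ X), IsAffine V → IrreducibleSpace V → Etale g →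
      PreconnectedSpace ↥(pullback g f))
    {U : X.Opens} (hU : IsAffineOpen U) [Nonempty U] {K E : Type u} [Field K]
    [Algebra Γ(X, U) K] [IsFractionRing Γ(X, U) K] [Field E] [Algebra Γ(X, U) E] [Algebra K E]
    [IsScalarTower Γ(X, U) K E] (s : Spec (.of E) ⟶ Y) [IsPreimmersion s]
    (hs : ∀ x, s x = genericPoint Y)
    (hsf : s ≫ f = Spec.map (CommRingCat.ofHom (algebraMap Γ(X, U) E)) ≫ hU.fromSpec)
    {α : E} (hα : IsSeparable K α) : ∃ k : K, algebraMap K E k = α := by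
  have := isIntegrallyClosed_of_isAffineOpen hU
  obtain ⟨B, _, _, _, _, φ, hφ⟩ := exists_etale_of_isSeparable (A := Γ(X, U)) hα
  refine hφ fun ψ b ↦ ?_
  let γ : Spec (.of B) ⟶ Spec Γ(X, U) := Spec.map (CommRingCat.ofHom (algebraMap Γ(X, U) B))
  have hγ : Etale γ := by
    have : (CommRingCat.ofHom (algebraMap Γ(X, U) B)).hom.Etale := by
      simpa [RingHom.etale_algebraMap] using (inferInstance : Algebra.Etale Γ(X, U) B)
    exact HasRingHomProperty.Spec_iff.2 this
  have : IsOpenImmersion hU.fromSpec := inferInstance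
  let g : Spec (.of B) ⟶ X := γ ≫ hU.fromSpec
  have : IsDomain (CommRingCat.of B) := ‹IsDomain B›
  have : PreconnectedSpace ↥(pullback g f) := H _ g inferInstance inferInstance inferInstance
  let P := pullback (pullback.snd g f) s
  -- `P` is the part of `V ×[X] Y` over the generic point of `Y`.
  have : Subsingleton P := ⟨fun x y ↦ by
    apply (pullback.fst (pullback.snd g f) s).isEmbedding.injective
    apply eq_of_etale_of_preconnectedSpace (pullback.snd g f) <;>
    · rw [← Scheme.Hom.comp_apply, pullback.condition, Scheme.Hom.comp_apply, hs]⟩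
  have hspec : ∀ {F : Type u} [Field F] [Algebra Γ(X, U) F] (χ : B →ₐ[Γ(X, U)] F),
      Spec.map (CommRingCat.ofHom χ.toRingHom) ≫ g =
        Spec.map (CommRingCat.ofHom (algebraMap Γ(X, U) F)) ≫ hU.fromSpec := fun χ ↦ by
    rw [← Category.assoc, ← Spec.map_comp, ← CommRingCat.ofHom_comp]
    congr 3
    exact χ.comp_algebraMap
  let σ : Spec (.of E) ⟶ P := pullback.lift
    (pullback.lift (Spec.map (CommRingCat.ofHom φ.toRingHom)) s ((hspec φ).trans hsf.symm)) (𝟙 _)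
    (by rw [pullback.lift_snd, Category.id_comp])
  have : IsIso (pullback.snd (pullback.snd g f) s) :=
    isIso_of_etale_of_subsingleton_of_section _ σ (pullback.lift_snd _ _ _)
  let j : Spec (.of (AlgebraicClosure E)) ⟶ Spec (.of E) :=
    Spec.map (CommRingCat.ofHom (algebraMap E (AlgebraicClosure E)))
  have hj : Spec.map (CommRingCat.ofHom (algebraMap Γ(X, U) (AlgebraicClosure E))) =
      j ≫ Spec.map (CommRingCat.ofHom (algebraMap Γ(X, U) E)) := by
    rw [← Spec.map_comp, ← CommRingCat.ofHom_comp, ← IsScalarTower.algebraMap_eq]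
  -- Both `φ` and `ψ` give points of `P` over the algebraic closure of `E`, and these coincide.
  let τ : Spec (.of (AlgebraicClosure E)) ⟶ P := pullback.lift
    (pullback.lift (Spec.map (CommRingCat.ofHom ψ.toRingHom)) (j ≫ s) (by
      rw [hspec, hj, Category.assoc, Category.assoc, hsf])) j (pullback.lift_snd _ _ _)
  have hτ : τ = j ≫ σ := by
    rw [← cancel_mono (pullback.snd (pullback.snd g f) s), pullback.lift_snd, Category.assoc,
      pullback.lift_snd, Category.comp_id]
  have h := congr_arg (· ≫ pullback.fst (pullback.snd g f) s ≫ pullback.fst g f) hτ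
  simp only [τ, σ, j, pullback.lift_fst_assoc, pullback.lift_fst, Category.assoc,
    ← Spec.map_comp] at h
  exact congr($(Spec.map_injective h).hom b)

variable [IsDominant f]

lemma isPrimaryOnFunctionFields_of_forall_preconnectedSpace
    (H : ∀ (V : Scheme.{u}) (g : V ⟶ X), IsAffine V → IrreducibleSpace V → Etale g →
      PreconnectedSpace ↥(pullback g f)) : IsPrimaryOnFunctionFields f := by
  let _ : Algebra X.functionField Y.functionField := (functionFieldMap f).hom.toAlgebra
  refine eq_bot_iff.2 fun α hα ↦ ?_
  obtain ⟨_, ⟨U, hU, rfl⟩, hη, -⟩ :=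
    X.isBasis_affineOpens.exists_subset_of_mem_open (Set.mem_univ (genericPoint X)) isOpen_univ
  have hU : IsAffineOpen U := hU
  have : Nonempty U := ⟨⟨_, hη⟩⟩
  have := functionField_isFractionRing_of_isAffineOpen X U hU
  let _ : Algebra Γ(X, U) Y.functionField :=
    ((functionFieldMap f).hom.comp (X.germToFunctionField U).hom).toAlgebra
  have : IsScalarTower Γ(X, U) X.functionField Y.functionField := .of_algebraMap_eq fun _ ↦ rfl
  refine IntermediateField.mem_bot.2 ?_
  refine exists_algebraMap_eq_of_isSeparable_of_forall_preconnectedSpace H hU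
    (Y.fromSpecStalk (genericPoint Y)) ?_ ?_ (mem_separableClosure_iff.1 hα)
  · intro x
    rw [Subsingleton.elim (α := PrimeSpectrum Y.functionField) x (IsLocalRing.closedPoint _)]
    exact Scheme.fromSpecStalk_closedPoint
  · rw [← specMap_functionFieldMap_fromSpecStalk, ← hU.fromSpecStalk_eq_fromSpecStalk hη,
      IsAffineOpen.fromSpecStalk, ← Category.assoc, ← Spec.map_comp]
    rfl

lemma PullbackPreservesClopens.isPrimaryOnFunctionFields (hf : PullbackPreservesClopens f) :
    IsPrimaryOnFunctionFields f := by
  refine isPrimaryOnFunctionFields_of_forall_preconnectedSpace fun V g _ _ _ ↦ ?_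
  refine preconnectedSpace_of_forall_constant fun d hd x y ↦ ?_
  obtain ⟨c, hc⟩ := (hf V g inferInstance).2 ⟨d, hd⟩
  have hc' : ∀ t, c (pullback.fst g f t) = d t := DFunLike.congr_fun hc
  rw [← hc', ← hc']
  exact ((IsLocallyConstant.iff_continuous c).2 c.continuous).apply_eq_of_preconnectedSpace _ _

lemma PullbackPreservesPiZero.isPrimaryOnFunctionFields [QuasiSeparatedSpace X]
    (hf : PullbackPreservesPiZero f) : IsPrimaryOnFunctionFields f := by
  refine isPrimaryOnFunctionFields_of_forall_preconnectedSpace fun V g _ _ _ ↦ ?_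
  have hb := hf V g ⟨inferInstance, inferInstance, inferInstance⟩
  refine preconnectedSpace_iff_connectedComponent.2 fun x ↦ Set.eq_univ_of_forall fun y ↦ ?_
  have h : (ConnectedComponents.mk x) = ConnectedComponents.mk y :=
    hb.1 (Subsingleton.elim _ _)
  rw [ConnectedComponents.coe_eq_coe.1 h]
  exact mem_connectedComponent

end

end EtaleTopos

theorem mainTheorem7 :
    (∀ (𝒴 : Type u₁) [Category.{v₁} 𝒴] [Topoi.IsTopos.{w} 𝒴]
      (𝒳 : Type u₂) [Category.{v₂} 𝒳] [Topoi.IsTopos.{w} 𝒳]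
      (f : Topoi.GeometricMorphism 𝒴 𝒳)
      (𝒳₀ : ObjectProperty 𝒳) [ObjectProperty.Small.{w} 𝒳₀] (_ : 𝒳₀.IsSeparating),
      List.TFAE [
        PreservesFiniteCoproducts f.pushforward,
        ∀ U : 𝒳, f.DecompositionsDescendUniquely U,
        ∀ U : 𝒳, 𝒳₀ U → f.DecompositionsDescendUniquely U]) ∧
    (∀ (X Y : Scheme.{u}) [AlgebraicGeometry.IsIntegral X] [AlgebraicGeometry.IsIntegral Y]
      [EtaleTopos.IsNormalScheme X] [EtaleTopos.IsNormalScheme Y]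
      (f : Y ⟶ X) [IsDominant f]
      (𝒳₀ : ObjectProperty (EtaleTopos.EtaleSheaf X)) [ObjectProperty.Small.{u} 𝒳₀]
      (_ : 𝒳₀.IsSeparating),
      List.TFAE [
        PreservesFiniteCoproducts (EtaleTopos.etaleGeometricMorphism f).pushforward,
        ∀ U : EtaleTopos.EtaleSheaf X,
          (EtaleTopos.etaleGeometricMorphism f).DecompositionsDescendUniquely U,
        ∀ U : EtaleTopos.EtaleSheaf X, 𝒳₀ U →
          (EtaleTopos.etaleGeometricMorphism f).DecompositionsDescendUniquely U,
        EtaleTopos.GeometricallyConnectedGenericFibre f,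
        EtaleTopos.IsPrimaryOnFunctionFields f] ∧
      (QuasiSeparatedSpace X → List.TFAE [
        PreservesFiniteCoproducts (EtaleTopos.etaleGeometricMorphism f).pushforward,
        ∀ U : EtaleTopos.EtaleSheaf X,
          (EtaleTopos.etaleGeometricMorphism f).DecompositionsDescendUniquely U,
        ∀ U : EtaleTopos.EtaleSheaf X, 𝒳₀ U →
          (EtaleTopos.etaleGeometricMorphism f).DecompositionsDescendUniquely U,
        EtaleTopos.PullbackPreservesPiZero f,
        EtaleTopos.GeometricallyConnectedGenericFibre f,
        EtaleTopos.IsPrimaryOnFunctionFields f])) := by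
  refine ⟨fun 𝒴 _ _ 𝒳 _ _ f 𝒳₀ _ h𝒳₀ ↦ Topoi.tfae_preservesFiniteCoproducts_pushforward f 𝒳₀ h𝒳₀,
    fun X Y _ _ _ _ f _ 𝒳₀ _ h𝒳₀ ↦ ?_⟩
  have hA := Topoi.tfae_preservesFiniteCoproducts_pushforward
    (EtaleTopos.etaleGeometricMorphism f) 𝒳₀ h𝒳₀
  have h12 := hA.out 0 1
  have h13 := hA.out 0 2
  have h15 : PreservesFiniteCoproducts (EtaleTopos.etaleGeometricMorphism f).pushforward ↔
      EtaleTopos.GeometricallyConnectedGenericFibre f :=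
    (EtaleTopos.preservesFiniteCoproducts_pushforward_iff f).trans
      ⟨fun h ↦ h.isPrimaryOnFunctionFields.geometricallyConnectedGenericFibre,
        fun h ↦ h.pullbackPreservesClopens⟩
  have h56 : EtaleTopos.GeometricallyConnectedGenericFibre f ↔
      EtaleTopos.IsPrimaryOnFunctionFields f :=
    ⟨fun h ↦ h.pullbackPreservesClopens.isPrimaryOnFunctionFields,
      fun h ↦ h.geometricallyConnectedGenericFibre⟩
  constructor
  · tfae_have 1 ↔ 2 := h12
    tfae_have 1 ↔ 3 := h13
    tfae_have 1 ↔ 4 := h15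
    tfae_have 4 ↔ 5 := h56
    tfae_finish
  · intro _
    tfae_have 1 ↔ 2 := h12
    tfae_have 1 ↔ 3 := h13
    tfae_have 1 ↔ 5 := h15
    tfae_have 5 ↔ 6 := h56
    tfae_have 5 → 4 := fun h ↦ h.pullbackPreservesPiZero
    tfae_have 4 → 6 := fun h ↦ h.isPrimaryOnFunctionFields
    tfae_finish
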